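/- Let $(M,m,V,\varkappa)$ be a mechanical system with gyroscopic forces: $M$ is a smooth manifold, $m=\langle\cdot,\cdot\rangle$ a smooth Riemannian metric, $V$ a smooth function and $\varkappa$ a smooth closed $2$-form on $M$. Let $p:TM\to M$ be the projection, $K(w)=\frac12\langle w,w\rangle$, $\theta_w(X)=\langle w,Tp(X)\rangle$ and $\sigma=d\theta$. A motion of the system on an open interval $J$ is a curve $x=p\circ w$, where $w$ is an integral curve on $J$ of the vector field $X$ on $TM$ determined by $i_X(\sigma+p^*\varkappa)=-d(K+V\circ p)$. Suppose $\dim M=2$. Let $h\in\mathbb R$, $M_h=\{x\in M: V(x)<h\}$, and let $m_h=2(h-V)m$, a Riemannian metric on $M_h$. Let $o_h$ be the volume form of $m_h$ (defined at each point up to sign) and write $\varkappa=k_h\,o_h$, so that $|\varkappa/o_h|=|k_h|$ is well defined. Let $x:J\to M_h$ be a $C^2$ curve on an open interval $J$ with total energy $K(x'(t))+V(x(t))=h$ for all $t\in J$. Then $x$ can be parametrized by $m_h$-arclength, and for every such parametrization $\bar x(\tau)$ (oriented as $x$) the following are equivalent: (i) $x$ is a motion of the system on $J$; (ii) at every $\tau$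 the geodesic curvature of $\bar x$ in the metric $m_h$, that is $\bigl\|\frac{D}{d\tau}\frac{d\bar x}{d\tau}\bigr\|_{m_h}$ with the Levi-Civita covariant derivative $D$ of $m_h$, equals $|\varkappa/o_h|(\bar x(\tau))$, and, wherever $\varkappa_{\bar x(\tau)}\neq0$, the basis $\bigl\{\frac{D}{d\tau}\frac{d\bar x}{d\tau},\frac{d\bar x}{d\tau}\bigr\}$ of $T_{\bar x(\tau)}M$ (curvature vector first, tangent vector second) has the orientation given by $\varkappa$, i.e. $\varkappa\bigl(\frac{D}{d\tau}\frac{d\bar x}{d\tau},\frac{d\bar x}{d\tau}\bigr)>0$. -/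

import Mathlib

open Set
open scoped Manifold ContDiff

noncomputable section

namespace Gyro

section Forms

variable {E : Type*} [NormedAddCommGroup E] [NormedSpace ℝ E]
  {H : Type*} [TopologicalSpace H] (I : ModelWithCorners ℝ E H)
  {N : Type*} [TopologicalSpace N] [ChartedSpace H N]

/-- A field of alternating `k`-linear forms on the tangent spaces of `N`
(a differential `k`-form, before any smoothness is required). -/
abbrev FormField (N : Type*) [TopologicalSpace N] [ChartedSpace H N] (k : ℕ) : Type _ :=
  ∀ x : N, (TangentSpace I x) [⋀^Fin k]→L[ℝ] ℝ

variable {I}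

/-- The coordinate expression of a `k`-form in the preferred chart `φ` around `x₀`: the pull-back
`(φ⁻¹)^* α`, a form on the model vector space (meaningful on the target of the chart). -/
def FormField.inChart {k : ℕ} (α : FormField I N k) (x₀ : N) (y : E) : E [⋀^Fin k]→L[ℝ] ℝ :=
  (α ((extChartAt I x₀).symm y)).compContinuousLinearMap
    (mfderivWithin 𝓘(ℝ, E) I (extChartAt I x₀).symm (range I) y)

/-- A `k`-form is smooth if all its coordinate expressions are smooth. -/
def FormField.IsSmooth {k : ℕ} (α : FormField I N k) : Prop :=
  ∀ x₀ : N, ContDiffOn ℝ ∞ (α.inChart x₀) (extChartAt I x₀).target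

/-- The exterior derivative of a `k`-form: at `x`, take the exterior derivative of the coordinate
expression in the chart `φ` around `x`, and pull the result back by `φ`. -/
def FormField.extDer {k : ℕ} (α : FormField I N k) : FormField I N (k + 1) := fun x =>
  (extDerivWithin (α.inChart x) (range I) (extChartAt I x x)).compContinuousLinearMap
    (mfderiv I 𝓘(ℝ, E) (extChartAt I x) x)

end Forms

section Metrics

variable {E : Type*} [NormedAddCommGroup E] [NormedSpace ℝ E]
  {M : Type*} [TopologicalSpace M] [ChartedSpace E M]

/-- A field of bilinear forms on the tangent spaces of `M`; it is used for metrics that are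
Riemannian on an open subset of `M` only. -/
abbrev BilinField (E : Type*) [NormedAddCommGroup E] [NormedSpace ℝ E]
    (M : Type*) [TopologicalSpace M] [ChartedSpace E M] : Type _ :=
  ∀ x : M, TangentSpace 𝓘(ℝ, E) x →L[ℝ] TangentSpace 𝓘(ℝ, E) x →L[ℝ] ℝ

/-- The differential at `y` of the inverse of the preferred chart around `x₀`. -/
def chartFrame (x₀ : M) (y : E) :
    E →L[ℝ] TangentSpace 𝓘(ℝ, E) ((extChartAt 𝓘(ℝ, E) x₀).symm y) :=
  mfderiv 𝓘(ℝ, E) 𝓘(ℝ, E) (extChartAt 𝓘(ℝ, E) x₀).symm y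

/-- The coordinate expression `(a_{ij}(y))` of `g` in the preferred chart around `x₀`, as a bilinear
form on the model vector space depending on the point `y` of the target of the chart. -/
def BilinField.inChart (g : BilinField E M) (x₀ : M) (y : E) : E →L[ℝ] E →L[ℝ] ℝ :=
  (ContinuousLinearMap.precomp ℝ (chartFrame x₀ y)).comp
    ((g ((extChartAt 𝓘(ℝ, E) x₀).symm y)).comp (chartFrame x₀ y))

/-- Christoffel symbols of the first kind in the preferred chart around `x₀`:
`w ↦ ½ (∂_u g(v, w) + ∂_v g(u, w) - ∂_w g(u, v))`. -/
def BilinField.christoffelFirst (g : BilinField E M) (x₀ : M) (y u v : E) : E →L[ℝ] ℝ :=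
  let D : E →L[ℝ] E →L[ℝ] E →L[ℝ] ℝ := fderiv ℝ (g.inChart x₀) y
  (1 / 2 : ℝ) • (D u v + D v u - (D.flip u).flip v)

/-- Christoffel symbols of the second kind in the preferred chart around `x₀`: the vector
`Γ(u, v)` with `g(Γ(u, v), w) = ½ (∂_u g(v, w) + ∂_v g(u, w) - ∂_w g(u, v))` for all `w`. -/
def BilinField.christoffel (g : BilinField E M) (x₀ : M) (y u v : E) : E :=
  (g.inChart x₀ y).inverse (g.christoffelFirst x₀ y u v)

/-- The velocity of a curve in `M`. -/
def velocity (γ : ℝ → M) (t : ℝ) : TangentSpace 𝓘(ℝ, E) (γ t) :=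
  mfderiv 𝓘(ℝ, ℝ) 𝓘(ℝ, E) γ t (1 : ℝ)

/-- The covariant derivative `DW/dt` (for the Levi-Civita connection of `g`) of a vector field `W`
along the curve `γ`; in the chart `φ` around `γ t` it is
`dW^k/dt + Γ^k_{ij} (dγ^i/dt) W^j`. -/
def BilinField.covDerivAlong (g : BilinField E M) (γ : ℝ → M)
    (W : ∀ t : ℝ, TangentSpace 𝓘(ℝ, E) (γ t)) (t : ℝ) : TangentSpace 𝓘(ℝ, E) (γ t) :=
  let φ := extChartAt 𝓘(ℝ, E) (γ t)
  let q : ℝ → E := fun s => φ (γ s)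
  let Wφ : ℝ → E := fun s => mfderiv 𝓘(ℝ, E) 𝓘(ℝ, E) φ (γ s) (W s)
  mfderiv 𝓘(ℝ, E) 𝓘(ℝ, E) φ.symm (φ (γ t))
    (deriv Wφ t + g.christoffel (γ t) (q t) (deriv q t) (Wφ t))

/-- The curvature vector of a curve `γ` parametrized by arclength: the covariant derivative of
its tangent vector. -/
def BilinField.curvatureVector (g : BilinField E M) (γ : ℝ → M) (t : ℝ) :
    TangentSpace 𝓘(ℝ, E) (γ t) :=
  g.covDerivAlong γ (velocity γ) t

/-- The length of a tangent vector. -/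
def BilinField.norm (g : BilinField E M) {x : M} (v : TangentSpace 𝓘(ℝ, E) x) : ℝ :=
  Real.sqrt (g x v v)

/-- The (unsigned) geodesic curvature of a curve parametrized by arclength. -/
def BilinField.geodesicCurvature (g : BilinField E M) (γ : ℝ → M) (t : ℝ) : ℝ :=
  g.norm (g.curvatureVector γ t)

/-- `y`, defined on `L`, is the curve `x`, defined on `J`, parametrized by `g`-arclength:
`x = y ∘ s` for an arclength function `s : J → L` of `x`, that is, `ds/dt = |dx/dt|`. -/
def BilinField.IsArclengthParam (g : BilinField E M) (J : Set ℝ) (x : ℝ → M)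
    (L : Set ℝ) (y : ℝ → M) : Prop :=
  ∃ s : ℝ → ℝ, (∀ t ∈ J, HasDerivAt s (g.norm (velocity x t)) t) ∧ s '' J = L ∧
    ∀ t ∈ J, x t = y (s t)

/-- `o` is one of the two volume forms of the metric `g` on the plane `T_x M`
(one for each orientation): it takes the values `±1` on orthonormal bases. -/
def BilinField.IsAreaFormAt (g : BilinField E M) (x : M)
    (o : TangentSpace 𝓘(ℝ, E) x [⋀^Fin 2]→L[ℝ] ℝ) : Prop :=
  ∀ e₁ e₂ : TangentSpace 𝓘(ℝ, E) x,
    g x e₁ e₁ = 1 → g x e₂ e₂ = 1 → g x e₁ e₂ = 0 → |o ![e₁, e₂]| = 1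

end Metrics

/-- A mechanical system with gyroscopic forces `(M, m, V, κ)`: a smooth manifold `M` (here modelled
on the finite-dimensional vector space `E`, without boundary), a smooth Riemannian metric `m`,
a smooth potential `V` and a smooth closed 2-form `κ`. -/
structure GyroSystem (E : Type*) [NormedAddCommGroup E] [NormedSpace ℝ E]
    (M : Type*) [TopologicalSpace M] [ChartedSpace E M] [IsManifold 𝓘(ℝ, E) ∞ M] where
  /-- the Riemannian metric -/
  m : Bundle.ContMDiffRiemannianMetric 𝓘(ℝ, E) ∞ E (fun x : M => TangentSpace 𝓘(ℝ, E) x)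
  /-- the potential -/
  V : M → ℝ
  V_smooth : ContMDiff 𝓘(ℝ, E) 𝓘(ℝ, ℝ) ∞ V
  /-- the 2-form of gyroscopic forces -/
  κ : FormField 𝓘(ℝ, E) M 2
  κ_smooth : κ.IsSmooth
  κ_closed : ∀ x : M, κ.extDer x = 0

namespace GyroSystem

variable {E : Type*} [NormedAddCommGroup E] [NormedSpace ℝ E]
  {M : Type*} [TopologicalSpace M] [ChartedSpace E M] [IsManifold 𝓘(ℝ, E) ∞ M]
  (S : GyroSystem E M)

/-- The kinetic energy `K(w) = ½ ⟨w, w⟩`, a function on the tangent bundle. -/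
def kinetic (w : TangentBundle 𝓘(ℝ, E) M) : ℝ :=
  (1 / 2) * S.m.inner w.proj w.snd w.snd

/-- The total energy `K + V ∘ p` (where `p` is the projection of the tangent bundle). -/
def energy (w : TangentBundle 𝓘(ℝ, E) M) : ℝ :=
  S.kinetic w + S.V w.proj

/-- The differential `Tp` of the projection `p` of the tangent bundle. -/
def projDiff (w : TangentBundle 𝓘(ℝ, E) M) :
    TangentSpace 𝓘(ℝ, E).tangent w →L[ℝ] TangentSpace 𝓘(ℝ, E) w.proj :=
  mfderiv 𝓘(ℝ, E).tangent 𝓘(ℝ, E) (fun u : TangentBundle 𝓘(ℝ, E) M => u.proj) w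

/-- The Lagrange 1-form `θ_w(X) = ⟨w, Tp X⟩` on the tangent bundle. -/
def lagrangeOne : FormField 𝓘(ℝ, E).tangent (TangentBundle 𝓘(ℝ, E) M) 1 := fun w =>
  ContinuousAlternatingMap.ofSubsingleton ℝ (TangentSpace 𝓘(ℝ, E).tangent w) ℝ (0 : Fin 1)
    ((S.m.inner w.proj w.snd).comp (projDiff w))

/-- The Lagrange 2-form `σ = dθ`. -/
def lagrangeTwo : FormField 𝓘(ℝ, E).tangent (TangentBundle 𝓘(ℝ, E) M) 2 :=
  S.lagrangeOne.extDer

/-- The pull-back `p^* κ` to the tangent bundle. -/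
def pullbackκ : FormField 𝓘(ℝ, E).tangent (TangentBundle 𝓘(ℝ, E) M) 2 := fun w =>
  (S.κ w.proj).compContinuousLinearMap (projDiff w)

/-- `X` is the dynamical system corresponding to `S`: the vector field on the tangent bundle with
`i_X (σ + p^* κ) = - d(K + V ∘ p)`. -/
def IsDynamicalField
    (X : ∀ w : TangentBundle 𝓘(ℝ, E) M, TangentSpace 𝓘(ℝ, E).tangent w) : Prop :=
  ∀ (w : TangentBundle 𝓘(ℝ, E) M) (Y : TangentSpace 𝓘(ℝ, E).tangent w),
    (S.lagrangeTwo w + S.pullbackκ w) ![X w, Y] =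
      -(mfderiv 𝓘(ℝ, E).tangent 𝓘(ℝ, ℝ) S.energy w Y : ℝ)

/-- `x`, defined on the interval `J`, is a motion of `S`: the projection of an integral curve of
the dynamical system of `S`. -/
def IsMotionOn (x : ℝ → M) (J : Set ℝ) : Prop :=
  ∃ X : ∀ w : TangentBundle 𝓘(ℝ, E) M, TangentSpace 𝓘(ℝ, E).tangent w,
    S.IsDynamicalField X ∧
    ∃ w : ℝ → TangentBundle 𝓘(ℝ, E) M, IsMIntegralCurveOn w X J ∧ ∀ t ∈ J, x t = (w t).proj

/-- The region of possible motions `M_h = {V < h}`. -/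
def region (h : ℝ) : Set M := {x | S.V x < h}

/-- The metric `m_h = 2 (h - V) m`, which is Riemannian on `M_h`. -/
def jacobiMetric (h : ℝ) : BilinField E M := fun x => (2 * (h - S.V x)) • S.m.inner x

end GyroSystem

end Gyro

end

noncomputable section

namespace Gyro

section Plane

variable {F : Type*} [AddCommGroup F] [Module ℝ F] [TopologicalSpace F]

/-- A vector of a Euclidean plane is determined by its components along an orthonormal basis. -/
theorem eq_smul_add_smul_of_orthonormal (hdim : Module.finrank ℝ F = 2) (B : F →L[ℝ] F →L[ℝ] ℝ)
    (hsymm : ∀ u v, B u v = B v u) {T N : F}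
    (hT : B T T = 1) (hN : B N N = 1) (hTN : B T N = 0) (u : F) :
    u = B u T • T + B u N • N := by
  have hli : LinearIndependent ℝ ![T, N] := by
    rw [LinearIndependent.pair_iff]
    intro a b hab
    have h1 : B (a • T + b • N) T = 0 := by rw [hab]; simp
    have h2 : B (a • T + b • N) N = 0 := by rw [hab]; simp
    simp [hT, hN, hTN, hsymm N T] at h1 h2
    exact ⟨h1, h2⟩
  have : Module.Finite ℝ F := Module.finite_of_finrank_pos (by omega)
  have hspan := hli.span_eq_top_of_card_eq_finrank' (by simp [hdim])
  have hu : u ∈ Submodule.span ℝ (Set.range ![T, N]) := by rw [hspan]; trivial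
  rw [Matrix.range_cons, Matrix.range_cons, Matrix.range_empty, Set.union_empty,
    Set.singleton_union, Submodule.mem_span_pair] at hu
  obtain ⟨a, b, rfl⟩ := hu
  simp [hT, hN, hTN, hsymm N T]

theorem twoForm_smul (κ : F [⋀^Fin 2]→L[ℝ] ℝ) (r : ℝ) (u v : F) :
    κ ![r • u, v] = r * κ ![u, v] := by
  have h : ∀ b : F, Function.update ![u, v] 0 b = ![b, v] := fun b => by
    ext i; fin_cases i <;> rfl
  simpa only [h, smul_eq_mul] using κ.map_update_smul ![u, v] 0 r u

/-- The value of a 2-form of a Euclidean plane in terms of its value on an orthonormal basis. -/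
theorem twoForm_apply_of_orthonormal (hdim : Module.finrank ℝ F = 2) (B : F →L[ℝ] F →L[ℝ] ℝ)
    (hsymm : ∀ u v, B u v = B v u) {T N : F}
    (hT : B T T = 1) (hN : B N N = 1) (hTN : B T N = 0) (κ : F [⋀^Fin 2]→L[ℝ] ℝ) (u v : F) :
    κ ![u, v] = (B u T * B v N - B u N * B v T) * κ ![T, N] := by
  have up₀ : ∀ a b c : F, Function.update ![a, c] 0 b = ![b, c] := fun a b c => by
    ext i; fin_cases i <;> rfl
  have up₁ : ∀ a b c : F, Function.update ![a, b] 1 c = ![a, c] := fun a b c => by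
    ext i; fin_cases i <;> rfl
  have add₀ : ∀ a b c : F, κ ![a + b, c] = κ ![a, c] + κ ![b, c] := fun a b c => by
    simpa only [up₀] using κ.map_update_add ![a, c] 0 a b
  have add₁ : ∀ a b c : F, κ ![a, b + c] = κ ![a, b] + κ ![a, c] := fun a b c => by
    simpa only [up₁] using κ.map_update_add ![a, c] 1 b c
  have smul₁ : ∀ (r : ℝ) (a c : F), κ ![a, r • c] = r * κ ![a, c] := fun r a c => by
    simpa only [up₁, smul_eq_mul] using κ.map_update_smul ![a, c] 1 r c
  have self : ∀ a : F, κ ![a, a] = 0 := fun a =>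
    κ.map_eq_zero_of_eq ![a, a] (i := 0) (j := 1) rfl (by decide)
  have swap : κ ![N, T] = - κ ![T, N] := by
    have := self (T + N)
    simp only [add₀, add₁, self] at this
    linarith
  conv_lhs => rw [eq_smul_add_smul_of_orthonormal hdim B hsymm hT hN hTN u,
    eq_smul_add_smul_of_orthonormal hdim B hsymm hT hN hTN v]
  simp only [add₀, add₁, twoForm_smul, smul₁, self, swap]
  ring

/-- The 2-form `u ∧ v ↦ f(u) g(v) - g(u) f(v)`. -/
def wedgeForm (f g : F →L[ℝ] ℝ) : F [⋀^Fin 2]→L[ℝ] ℝ where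
  toFun v := f (v 0) * g (v 1) - g (v 0) * f (v 1)
  map_update_add' := by
    intro inst m i x y
    rw [Subsingleton.elim inst (instDecidableEqFin 2)]
    fin_cases i <;> simp <;> ring
  map_update_smul' := by
    intro inst m i c x
    rw [Subsingleton.elim inst (instDecidableEqFin 2)]
    fin_cases i <;> simp <;> ring
  cont := by fun_prop
  map_eq_zero_of_eq' := by
    intro v i j hij hne
    fin_cases i <;> fin_cases j <;> simp_all <;> ring

@[simp]
theorem wedgeForm_apply (f g : F →L[ℝ] ℝ) (u v : F) :
    wedgeForm f g ![u, v] = f u * g v - g u * f v := rfl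

/-- In a Euclidean plane, every unit vector has a unit vector orthogonal to it. -/
theorem exists_unit_orthogonal (hdim : Module.finrank ℝ F = 2) (B : F →L[ℝ] F →L[ℝ] ℝ)
    (hsymm : ∀ u v, B u v = B v u) (hpos : ∀ u, u ≠ 0 → 0 < B u u) {T : F} (hT : B T T = 1) :
    ∃ N, B N N = 1 ∧ B T N = 0 := by
  obtain ⟨u, hu⟩ : ∃ u, ∀ c : ℝ, c • T ≠ u := by
    by_contra! hc
    have := (finrank_le_one T hc : Module.finrank ℝ F ≤ 1)
    omega
  set n := u - B u T • T with hn
  have hn0 : n ≠ 0 := fun h0 => hu (B u T) (sub_eq_zero.mp h0).symm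
  have hnT : B T n = 0 := by simp [hn, hT, hsymm T u]
  have hnn := hpos n hn0
  refine ⟨(Real.sqrt (B n n))⁻¹ • n, ?_, by simp [hnT]⟩
  have hs : Real.sqrt (B n n) ≠ 0 := (Real.sqrt_pos.mpr hnn).ne'
  have := Real.mul_self_sqrt hnn.le
  simp only [map_smul, smul_apply, smul_eq_mul]
  field_simp
  nlinarith

/-- In an oriented Euclidean plane with a unit vector `T` and a vector `k` orthogonal to it, the
equation `⟨k, ·⟩ = -κ(T, ·)` says that `|k| = |κ / o|` for the area form `o`, and that `(k, T)` is
positively oriented with respect to `κ` unless `κ = 0`. -/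
theorem inner_eq_neg_twoForm_iff (hdim : Module.finrank ℝ F = 2) (B : F →L[ℝ] F →L[ℝ] ℝ)
    (hsymm : ∀ u v, B u v = B v u) (hpos : ∀ u, u ≠ 0 → 0 < B u u) {T k : F} (hT : B T T = 1)
    (hk : B k T = 0) (κ : F [⋀^Fin 2]→L[ℝ] ℝ) :
    (∀ Y, B k Y = - κ ![T, Y]) ↔
      (∃ (o : F [⋀^Fin 2]→L[ℝ] ℝ) (c : ℝ),
        (∀ e₁ e₂, B e₁ e₁ = 1 → B e₂ e₂ = 1 → B e₁ e₂ = 0 → |o ![e₁, e₂]| = 1) ∧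
        κ = c • o ∧ Real.sqrt (B k k) = |c|) ∧ (κ ≠ 0 → 0 < κ ![k, T]) := by
  obtain ⟨N, hN, hTN⟩ := exists_unit_orthogonal hdim B hsymm hpos hT
  have hexp := eq_smul_add_smul_of_orthonormal hdim B hsymm hT hN hTN
  have hform := twoForm_apply_of_orthonormal hdim B hsymm hT hN hTN
  have hin : ∀ u v, B u v = B u T * B v T + B u N * B v N := by
    intro u v
    conv_lhs => rw [hexp v]
    simp; ring
  have hNT : B N T = 0 := by rw [hsymm, hTN]
  have hkk : Real.sqrt (B k k) = |B k N| := by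
    rw [hin, hk, ← Real.sqrt_mul_self_eq_abs]; ring_nf
  have hkT : κ ![k, T] = - (B k N * κ ![T, N]) := by rw [hform]; simp [hT, hTN]
  have hκ : κ = κ ![T, N] • wedgeForm (B T) (B N) := by
    ext v
    have hv : v = ![v 0, v 1] := by ext i; fin_cases i <;> rfl
    rw [hv, hform]
    simp [hsymm T, hsymm N]; ring
  have key : (∀ Y, B k Y = - κ ![T, Y]) ↔ B k N = - κ ![T, N] := by
    refine ⟨fun h => h N, fun h Y => ?_⟩
    rw [hin, hform κ T Y, hk, hT, hTN, h]; ring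
  rw [key]
  constructor
  · intro h
    refine ⟨⟨wedgeForm (B T) (B N), κ ![T, N], ?_, hκ, ?_⟩, ?_⟩
    · intro e₁ e₂ h1 h2 h12
      rw [hin] at h1 h2 h12
      rw [wedgeForm_apply, hsymm T, hsymm N, hsymm T, hsymm N, ← abs_one,
        ← sq_eq_sq_iff_abs_eq_abs, one_pow]
      linear_combination (B e₂ T * B e₂ T + B e₂ N * B e₂ N) * h1 + h2 -
        (B e₁ T * B e₂ T + B e₁ N * B e₂ N) * h12
    · rw [hkk, h, abs_neg]
    · intro h0
      rw [hkT, h]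
      have : κ ![T, N] ≠ 0 := fun h1 => h0 (by rw [hκ, h1, zero_smul])
      nlinarith [mul_self_pos.mpr this]
  · rintro ⟨⟨o, c, ho, hc, hn⟩, hκ0⟩
    have habs : |B k N| = |κ ![T, N]| := by
      rw [← hkk, hn, hc]; simp [abs_mul, ho T N hT hN hTN]
    by_cases h0 : κ = 0
    · simpa [h0] using habs
    · have := hκ0 h0
      rw [hkT] at this
      rcases abs_eq_abs.mp habs with h1 | h1
      · rw [h1] at this; nlinarith [mul_self_nonneg (κ ![T, N])]
      · exact h1

end Plane

section Charts

variable {E : Type*} [NormedAddCommGroup E] [NormedSpace ℝ E]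
  {M : Type*} [TopologicalSpace M] [ChartedSpace E M] [IsManifold 𝓘(ℝ, E) ∞ M]

theorem mdifferentiableAt_chart {x₀ x : M} (hx : x ∈ (extChartAt 𝓘(ℝ, E) x₀).source) :
    MDifferentiableAt 𝓘(ℝ, E) 𝓘(ℝ, E) (extChartAt 𝓘(ℝ, E) x₀) x :=
  mdifferentiableAt_extChartAt (by rwa [← extChartAt_source 𝓘(ℝ, E)])

theorem mdifferentiableAt_chart_symm {x₀ : M} {y : E} (hy : y ∈ (extChartAt 𝓘(ℝ, E) x₀).target) :
    MDifferentiableAt 𝓘(ℝ, E) 𝓘(ℝ, E) (extChartAt 𝓘(ℝ, E) x₀).symm y := by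
  simpa [mdifferentiableWithinAt_univ] using
    mdifferentiableWithinAt_extChartAt_symm (I := 𝓘(ℝ, E)) hy

/-- The differential at `x` of the preferred chart around `x₀`. -/
def chartDiff (x₀ x : M) : TangentSpace 𝓘(ℝ, E) x →L[ℝ] E :=
  mfderiv 𝓘(ℝ, E) 𝓘(ℝ, E) (extChartAt 𝓘(ℝ, E) x₀) x

theorem chartDiff_chartFrame {x₀ : M} {y : E} (hy : y ∈ (extChartAt 𝓘(ℝ, E) x₀).target)
    (v : E) : chartDiff x₀ ((extChartAt 𝓘(ℝ, E) x₀).symm y) (chartFrame x₀ y v) = v := by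
  have := mfderiv_extChartAt_comp_mfderivWithin_extChartAt_symm (I := 𝓘(ℝ, E)) hy
  rw [ModelWithCorners.range_eq_univ, mfderivWithin_univ] at this
  exact congrArg (fun A : E →L[ℝ] E => A v) this

theorem chartFrame_chartDiff {x₀ x : M} (hx : x ∈ (extChartAt 𝓘(ℝ, E) x₀).source)
    (u : TangentSpace 𝓘(ℝ, E) x) :
    (chartFrame x₀ (extChartAt 𝓘(ℝ, E) x₀ x) (chartDiff x₀ x u) : E) = u := by
  have := mfderivWithin_extChartAt_symm_comp_mfderiv_extChartAt' (I := 𝓘(ℝ, E)) hx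
  rw [ModelWithCorners.range_eq_univ, mfderivWithin_univ] at this
  exact congrArg (fun A : E →L[ℝ] E => A u) this

/-- The preferred charts of the tangent bundle are the differentials of the charts of the base. -/
theorem extChartAt_tangent_apply (w₀ : TangentBundle 𝓘(ℝ, E) M) {x : M}
    (hx : x ∈ (extChartAt 𝓘(ℝ, E) w₀.proj).source) (u : TangentSpace 𝓘(ℝ, E) x) :
    extChartAt 𝓘(ℝ, E).tangent w₀ ⟨x, u⟩ =
      (extChartAt 𝓘(ℝ, E) w₀.proj x, chartDiff w₀.proj x u) := by
  have hx' : x ∈ (chartAt E w₀.proj).source := by rwa [← extChartAt_source 𝓘(ℝ, E)]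
  have h1 : (trivializationAt E (TangentSpace 𝓘(ℝ, E)) w₀.proj).continuousLinearMapAt ℝ x =
      chartDiff w₀.proj x := TangentBundle.continuousLinearMapAt_trivializationAt hx'
  rw [← h1, Bundle.Trivialization.continuousLinearMapAt_apply,
    Bundle.Trivialization.coe_linearMapAt_of_mem _ hx', FiberBundle.extChartAt]
  rfl

theorem extChartAt_tangent_source (w₀ : TangentBundle 𝓘(ℝ, E) M) :
    (extChartAt 𝓘(ℝ, E).tangent w₀).source =
      (fun w => w.proj) ⁻¹' (extChartAt 𝓘(ℝ, E) w₀.proj).source := by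
  ext w
  rw [extChartAt_source, extChartAt_source]
  exact TangentBundle.mem_chart_source_iff _ _

theorem mem_extChartAt_tangent_target (w₀ : TangentBundle 𝓘(ℝ, E) M) {z : E × E} :
    z ∈ (extChartAt 𝓘(ℝ, E).tangent w₀).target ↔ z.1 ∈ (extChartAt 𝓘(ℝ, E) w₀.proj).target := by
  rw [FiberBundle.extChartAt_target]
  simp only [mem_prod, mem_inter_iff, mem_preimage, mem_univ, and_true, and_iff_left_iff_imp]
  intro h
  have := (extChartAt 𝓘(ℝ, E) w₀.proj).map_target h
  rwa [extChartAt_source] at this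

theorem extChartAt_tangent_symm (w₀ : TangentBundle 𝓘(ℝ, E) M) {y : E}
    (hy : y ∈ (extChartAt 𝓘(ℝ, E) w₀.proj).target) (v : E) :
    (extChartAt 𝓘(ℝ, E).tangent w₀).symm (y, v) =
      (⟨(extChartAt 𝓘(ℝ, E) w₀.proj).symm y, chartFrame w₀.proj y v⟩ :
        TangentBundle 𝓘(ℝ, E) M) := by
  have hx := (extChartAt 𝓘(ℝ, E) w₀.proj).map_target hy
  apply (extChartAt 𝓘(ℝ, E).tangent w₀).injOn
  · exact (extChartAt 𝓘(ℝ, E).tangent w₀).map_target ((mem_extChartAt_tangent_target w₀).mpr hy)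
  · rw [extChartAt_tangent_source]; exact hx
  · rw [(extChartAt 𝓘(ℝ, E).tangent w₀).right_inv ((mem_extChartAt_tangent_target w₀).mpr hy),
      extChartAt_tangent_apply w₀ hx, chartDiff_chartFrame hy,
      (extChartAt 𝓘(ℝ, E) w₀.proj).right_inv hy]

end Charts

section TangentCharts

variable {E : Type*} [NormedAddCommGroup E] [NormedSpace ℝ E]
  {M : Type*} [TopologicalSpace M] [ChartedSpace E M] [IsManifold 𝓘(ℝ, E) ∞ M]

/-- The differential at `w` of the preferred chart of the tangent bundle around `w₀`. -/
def tangentChartDiff (w₀ w : TangentBundle 𝓘(ℝ, E) M) :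
    TangentSpace 𝓘(ℝ, E).tangent w →L[ℝ] E × E :=
  mfderiv 𝓘(ℝ, E).tangent 𝓘(ℝ, E × E) (extChartAt 𝓘(ℝ, E).tangent w₀) w

/-- The differential at `z` of the inverse of the preferred chart of the tangent bundle
around `w₀`. -/
def tangentChartFrame (w₀ : TangentBundle 𝓘(ℝ, E) M) (z : E × E) :
    E × E →L[ℝ] TangentSpace 𝓘(ℝ, E).tangent ((extChartAt 𝓘(ℝ, E).tangent w₀).symm z) :=
  mfderivWithin 𝓘(ℝ, E × E) 𝓘(ℝ, E).tangent (extChartAt 𝓘(ℝ, E).tangent w₀).symm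
    (range 𝓘(ℝ, E).tangent) z

theorem mdifferentiableAt_tangentChart_symm (w₀ : TangentBundle 𝓘(ℝ, E) M) {z : E × E}
    (hz : z ∈ (extChartAt 𝓘(ℝ, E).tangent w₀).target) :
    MDifferentiableAt 𝓘(ℝ, E × E) 𝓘(ℝ, E).tangent (extChartAt 𝓘(ℝ, E).tangent w₀).symm z := by
  have := mdifferentiableWithinAt_extChartAt_symm (I := 𝓘(ℝ, E).tangent) hz
  rwa [ModelWithCorners.range_eq_univ, mdifferentiableWithinAt_univ] at this

theorem tangentChartFrame_eq_mfderiv (w₀ : TangentBundle 𝓘(ℝ, E) M) (z : E × E) :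
    tangentChartFrame w₀ z =
      mfderiv 𝓘(ℝ, E × E) 𝓘(ℝ, E).tangent (extChartAt 𝓘(ℝ, E).tangent w₀).symm z := by
  rw [tangentChartFrame, ModelWithCorners.range_eq_univ, mfderivWithin_univ]

theorem tangentChartDiff_tangentChartFrame {w₀ w : TangentBundle 𝓘(ℝ, E) M}
    (hw : w ∈ (extChartAt 𝓘(ℝ, E).tangent w₀).source) (ζ : E × E) :
    tangentChartDiff w₀ w
      (tangentChartFrame w₀ (extChartAt 𝓘(ℝ, E).tangent w₀ w) ζ : E × E) = ζ := by
  have := mfderiv_extChartAt_comp_mfderivWithin_extChartAt_symm' (I := 𝓘(ℝ, E).tangent) hw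
  exact congrArg (fun A : E × E →L[ℝ] E × E => A ζ) this

theorem tangentChartFrame_tangentChartDiff {w₀ w : TangentBundle 𝓘(ℝ, E) M}
    (hw : w ∈ (extChartAt 𝓘(ℝ, E).tangent w₀).source) (Z : TangentSpace 𝓘(ℝ, E).tangent w) :
    (tangentChartFrame w₀ (extChartAt 𝓘(ℝ, E).tangent w₀ w) (tangentChartDiff w₀ w Z) : E × E)
      = Z := by
  have := mfderivWithin_extChartAt_symm_comp_mfderiv_extChartAt' (I := 𝓘(ℝ, E).tangent) hw
  exact congrArg (fun A : E × E →L[ℝ] E × E => A Z) this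

theorem mdifferentiableAt_proj (w : TangentBundle 𝓘(ℝ, E) M) :
    MDifferentiableAt 𝓘(ℝ, E).tangent 𝓘(ℝ, E) (fun u : TangentBundle 𝓘(ℝ, E) M => u.proj) w :=
  Bundle.mdifferentiableAt_proj _

theorem projDiff_tangentChartFrame (w₀ : TangentBundle 𝓘(ℝ, E) M) {z : E × E}
    (hz : z ∈ (extChartAt 𝓘(ℝ, E).tangent w₀).target) (ζ : E × E) :
    (GyroSystem.projDiff ((extChartAt 𝓘(ℝ, E).tangent w₀).symm z) (tangentChartFrame w₀ z ζ) : E)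
      = chartFrame w₀.proj z.1 ζ.1 := by
  have hz1 := (mem_extChartAt_tangent_target w₀).mp hz
  have h1 : HasMFDerivAt 𝓘(ℝ, E × E) 𝓘(ℝ, E)
      ((fun u : TangentBundle 𝓘(ℝ, E) M => u.proj) ∘ (extChartAt 𝓘(ℝ, E).tangent w₀).symm) z
      ((GyroSystem.projDiff ((extChartAt 𝓘(ℝ, E).tangent w₀).symm z)).comp
        (tangentChartFrame w₀ z)) := by
    rw [tangentChartFrame_eq_mfderiv]
    exact (mdifferentiableAt_proj _).hasMFDerivAt.comp z
      (mdifferentiableAt_tangentChart_symm w₀ hz).hasMFDerivAt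
  have h2 : HasMFDerivAt 𝓘(ℝ, E × E) 𝓘(ℝ, E)
      ((extChartAt 𝓘(ℝ, E) w₀.proj).symm ∘ (Prod.fst : E × E → E)) z
      ((chartFrame w₀.proj z.1).comp (ContinuousLinearMap.fst ℝ E E)) :=
    (mdifferentiableAt_chart_symm hz1).hasMFDerivAt.comp z
      (hasFDerivAt_fst.hasMFDerivAt)
  have h3 : (extChartAt 𝓘(ℝ, E) w₀.proj).symm ∘ (Prod.fst : E × E → E) =ᶠ[nhds z]
      (fun u : TangentBundle 𝓘(ℝ, E) M => u.proj) ∘ (extChartAt 𝓘(ℝ, E).tangent w₀).symm := by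
    filter_upwards [(isOpen_extChartAt_target w₀).mem_nhds hz] with y hy
    rw [Function.comp_apply, Function.comp_apply, ← Prod.mk.eta (p := y),
      extChartAt_tangent_symm w₀ ((mem_extChartAt_tangent_target w₀).mp hy)]
  have h4 := hasMFDerivAt_unique h1 (h2.congr_of_eventuallyEq h3.symm)
  exact congrArg (fun A : E × E →L[ℝ] E => A ζ) h4

theorem exists_tangentChartDiff_eq (w : TangentBundle 𝓘(ℝ, E) M) (ζ : E × E) :
    ∃ Z : TangentSpace 𝓘(ℝ, E).tangent w, tangentChartDiff w w Z = ζ :=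
  ⟨_, tangentChartDiff_tangentChartFrame (mem_extChartAt_source w) ζ⟩

theorem mdifferentiableAt_tangentChart (w : TangentBundle 𝓘(ℝ, E) M) :
    MDifferentiableAt 𝓘(ℝ, E).tangent 𝓘(ℝ, E × E) (extChartAt 𝓘(ℝ, E).tangent w) w :=
  mdifferentiableAt_extChartAt (mem_chart_source _ w)

theorem chartDiff_projDiff (w : TangentBundle 𝓘(ℝ, E) M) (Z : TangentSpace 𝓘(ℝ, E).tangent w) :
    chartDiff w.proj w.proj (GyroSystem.projDiff w Z) = (tangentChartDiff w w Z).1 := by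
  have h1 : HasMFDerivAt 𝓘(ℝ, E).tangent 𝓘(ℝ, E)
      (extChartAt 𝓘(ℝ, E) w.proj ∘ (fun u : TangentBundle 𝓘(ℝ, E) M => u.proj)) w
      ((chartDiff (E := E) w.proj w.proj).comp (GyroSystem.projDiff w)) :=
    (mdifferentiableAt_chart (mem_extChartAt_source w.proj)).hasMFDerivAt.comp w
      (mdifferentiableAt_proj w).hasMFDerivAt
  have h2 : HasMFDerivAt 𝓘(ℝ, E).tangent 𝓘(ℝ, E)
      ((Prod.fst : E × E → E) ∘ extChartAt 𝓘(ℝ, E).tangent w) w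
      ((ContinuousLinearMap.fst ℝ E E).comp (tangentChartDiff w w)) :=
    hasFDerivAt_fst.hasMFDerivAt.comp w (mdifferentiableAt_tangentChart w).hasMFDerivAt
  have h3 : (Prod.fst : E × E → E) ∘ extChartAt 𝓘(ℝ, E).tangent w =ᶠ[nhds w]
      extChartAt 𝓘(ℝ, E) w.proj ∘ (fun u : TangentBundle 𝓘(ℝ, E) M => u.proj) := by
    filter_upwards [extChartAt_source_mem_nhds (I := 𝓘(ℝ, E).tangent) w] with u hu
    rw [extChartAt_tangent_source] at hu
    have := extChartAt_tangent_apply w hu u.snd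
    exact congrArg Prod.fst this
  have h4 := hasMFDerivAt_unique h1 (h2.congr_of_eventuallyEq h3.symm)
  exact congrArg (fun A : TangentSpace 𝓘(ℝ, E).tangent w →L[ℝ] E => A Z) h4

end TangentCharts

section Metric

variable {E : Type*} [NormedAddCommGroup E] [NormedSpace ℝ E]
  {M : Type*} [TopologicalSpace M] [ChartedSpace E M]

theorem BilinField.inChart_apply (g : BilinField E M) (x₀ : M) (y u v : E) :
    g.inChart x₀ y u v =
      g ((extChartAt 𝓘(ℝ, E) x₀).symm y) (chartFrame x₀ y u) (chartFrame x₀ y v) := rfl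

variable [IsManifold 𝓘(ℝ, E) ∞ M] (S : GyroSystem E M)

namespace GyroSystem

/-- The Riemannian metric of the system as a field of bilinear forms. -/
def metric : BilinField E M := fun x => S.m.inner x

theorem contMDiffOn_chartFrame (x₀ : M) (v : E) :
    ContMDiffOn 𝓘(ℝ, E) 𝓘(ℝ, E).tangent ∞
      (fun y : E => (⟨(extChartAt 𝓘(ℝ, E) x₀).symm y, chartFrame x₀ y v⟩ :
        TangentBundle 𝓘(ℝ, E) M)) (extChartAt 𝓘(ℝ, E) x₀).target := by
  have h1 : ContMDiffOn 𝓘(ℝ, E) 𝓘(ℝ, E × E) ∞ (fun y : E => (y, v))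
      (extChartAt 𝓘(ℝ, E) x₀).target := by
    rw [contMDiffOn_iff_contDiffOn]
    fun_prop
  have h2 := contMDiffOn_extChartAt_symm (I := 𝓘(ℝ, E).tangent) (n := ∞)
    (⟨x₀, 0⟩ : TangentBundle 𝓘(ℝ, E) M)
  refine (h2.comp h1 fun y hy => ?_).congr fun y hy => ?_
  · exact (mem_extChartAt_tangent_target (⟨x₀, 0⟩ : TangentBundle 𝓘(ℝ, E) M)).mpr hy
  · exact (extChartAt_tangent_symm (⟨x₀, 0⟩ : TangentBundle 𝓘(ℝ, E) M) hy v).symm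

theorem contDiffOn_metric_inChart [FiniteDimensional ℝ E] (x₀ : M) :
    ContDiffOn ℝ ∞ (S.metric.inChart x₀) (extChartAt 𝓘(ℝ, E) x₀).target := by
  rw [contDiffOn_clm_apply]
  intro u
  rw [contDiffOn_clm_apply]
  intro v
  rw [← contMDiffOn_iff_contDiffOn]
  intro y hy
  have hu := contMDiffOn_chartFrame x₀ u y hy
  have hv := contMDiffOn_chartFrame x₀ v y hy
  have hb := contMDiffOn_extChartAt_symm (I := 𝓘(ℝ, E)) (n := ∞) x₀ y hy
  have : ContMDiffWithinAt 𝓘(ℝ, E) (𝓘(ℝ, E).prod 𝓘(ℝ)) ∞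
      (fun y ↦ Bundle.TotalSpace.mk' ℝ (E := Bundle.Trivial M ℝ) ((extChartAt 𝓘(ℝ, E) x₀).symm y)
        (S.m.inner ((extChartAt 𝓘(ℝ, E) x₀).symm y) (chartFrame x₀ y u) (chartFrame x₀ y v)))
      (extChartAt 𝓘(ℝ, E) x₀).target y := by
    apply ContMDiffWithinAt.clm_bundle_apply₂ (F₁ := E) (F₂ := E)
    · exact ContMDiffAt.comp_contMDiffWithinAt y S.m.contMDiff.contMDiffAt hb
    · exact hu
    · exact hv
  simp only [Bundle.contMDiffWithinAt_totalSpace] at this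
  exact this.2

theorem hasFDerivAt_metric_inChart [FiniteDimensional ℝ E] (x₀ : M) {y : E} (hy : y ∈ (extChartAt 𝓘(ℝ, E) x₀).target) :
    HasFDerivAt (S.metric.inChart x₀) (fderiv ℝ (S.metric.inChart x₀) y) y :=
  (((S.contDiffOn_metric_inChart x₀).contDiffAt
    ((isOpen_extChartAt_target x₀).mem_nhds hy)).differentiableAt (by simp)).hasFDerivAt

theorem metric_inChart_symm (x₀ : M) (y u v : E) :
    S.metric.inChart x₀ y u v = S.metric.inChart x₀ y v u := S.m.symm _ _ _

/-- The potential in the preferred chart around `x₀`. -/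
def potentialInChart (x₀ : M) (y : E) : ℝ := S.V ((extChartAt 𝓘(ℝ, E) x₀).symm y)

theorem hasFDerivAt_potentialInChart (x₀ : M) {y : E}
    (hy : y ∈ (extChartAt 𝓘(ℝ, E) x₀).target) :
    HasFDerivAt (S.potentialInChart x₀) (fderiv ℝ (S.potentialInChart x₀) y) y := by
  have h := (S.V_smooth.mdifferentiableAt (by simp)).comp y (mdifferentiableAt_chart_symm hy)
  exact (mdifferentiableAt_iff_differentiableAt.mp h).hasFDerivAt

end GyroSystem

/-- The differentials of charts are injective. -/
theorem chartFrame_ne_zero {x₀ : M} {y : E} (hy : y ∈ (extChartAt 𝓘(ℝ, E) x₀).target) {v : E}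
    (hv : v ≠ 0) : chartFrame x₀ y v ≠ 0 := fun h => hv (by
  rw [← chartDiff_chartFrame hy v, h, map_zero])

theorem GyroSystem.metric_inChart_pos {x₀ : M} {y : E} (hy : y ∈ (extChartAt 𝓘(ℝ, E) x₀).target)
    {v : E} (hv : v ≠ 0) : 0 < S.metric.inChart x₀ y v v :=
  S.m.pos _ _ (chartFrame_ne_zero hy hv)

/-- A positive definite bilinear form on a finite-dimensional space is invertible. -/
theorem isInvertible_of_pos [FiniteDimensional ℝ E] (B : E →L[ℝ] E →L[ℝ] ℝ) (hB : ∀ v, v ≠ 0 → 0 < B v v) :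
    B.IsInvertible := by
  have hinj : Function.Injective B := by
    rw [injective_iff_map_eq_zero]
    intro v hv
    by_contra h
    have := hB v h
    simp [hv] at this
  have hdim : Module.finrank ℝ E = Module.finrank ℝ (E →L[ℝ] ℝ) := by
    rw [← (LinearMap.toContinuousLinearMap : (E →ₗ[ℝ] ℝ) ≃ₗ[ℝ] E →L[ℝ] ℝ).finrank_eq]
    exact (Subspace.dual_finrank_eq).symm
  refine ⟨(LinearEquiv.ofInjectiveOfFinrankEq B.toLinearMap hinj hdim).toContinuousLinearEquiv, ?_⟩
  ext v
  rfl

end Metric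

section Dynamics

variable {E : Type*} [NormedAddCommGroup E] [NormedSpace ℝ E]
  {M : Type*} [TopologicalSpace M] [ChartedSpace E M] [IsManifold 𝓘(ℝ, E) ∞ M]

theorem chartDiff_injective {x₀ x : M} (hx : x ∈ (extChartAt 𝓘(ℝ, E) x₀).source) :
    Function.Injective (chartDiff (E := E) x₀ x) := fun u v huv => by
  have hu := chartFrame_chartDiff hx u
  have hv := chartFrame_chartDiff hx v
  rw [huv] at hu
  exact hu.symm.trans hv

theorem exists_chartDiff_eq (x : M) (v : E) :
    ∃ u : TangentSpace 𝓘(ℝ, E) x, chartDiff x x u = v := by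
  have h := chartDiff_chartFrame (mem_extChartAt_target (I := 𝓘(ℝ, E)) x) v
  have h1 : ∀ p : M, p = x → ∀ u : E, chartDiff x p u = v →
      ∃ u : TangentSpace 𝓘(ℝ, E) x, chartDiff x x u = v := by
    rintro p rfl u hu; exact ⟨u, hu⟩
  exact h1 _ (extChartAt_to_inv x) _ h

theorem chartFrame_chartDiff_inner {g : BilinField E M} (x : M) (u v : TangentSpace 𝓘(ℝ, E) x) :
    g.inChart x (extChartAt 𝓘(ℝ, E) x x) (chartDiff x x u) (chartDiff x x v) = g x u v := by
  rw [BilinField.inChart_apply]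
  have hu := chartFrame_chartDiff (mem_extChartAt_source (I := 𝓘(ℝ, E)) x) u
  have hv := chartFrame_chartDiff (mem_extChartAt_source (I := 𝓘(ℝ, E)) x) v
  have h1 : ∀ p : M, p = x → ∀ u' : E, u' = u → ∀ v' : E, v' = v → g p u' v' = g x u v := by
    rintro p rfl u' rfl v' rfl; rfl
  exact h1 _ (extChartAt_to_inv x) _ hu _ hv

theorem hasFDerivAt_fst_apply_snd {F : Type*} [NormedAddCommGroup F] [NormedSpace ℝ F]
    {f : E → E →L[ℝ] F} {f' : E →L[ℝ] E →L[ℝ] F} {z : E × E} (hf : HasFDerivAt f f' z.1) :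
    HasFDerivAt (fun z : E × E => f z.1 z.2) ((f z.1).comp (ContinuousLinearMap.snd ℝ E E) +
      (f'.comp (ContinuousLinearMap.fst ℝ E E)).flip z.2) z := by
  have h : HasFDerivAt (fun z : E × E => f z.1) (f'.comp (ContinuousLinearMap.fst ℝ E E)) z :=
    HasFDerivAt.comp (G := E →L[ℝ] F) z hf hasFDerivAt_fst
  exact h.clm_apply hasFDerivAt_snd

namespace GyroSystem

variable (S : GyroSystem E M)

theorem lagrangeOne_inChart (w₀ : TangentBundle 𝓘(ℝ, E) M) {z : E × E}
    (hz : z ∈ (extChartAt 𝓘(ℝ, E).tangent w₀).target) :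
    S.lagrangeOne.inChart w₀ z =
      ContinuousAlternatingMap.ofSubsingletonLIE (𝕜 := ℝ) (E := E × E) (F := ℝ) (0 : Fin 1)
        ((S.metric.inChart w₀.proj z.1 z.2).comp (ContinuousLinearMap.fst ℝ E E)) := by
  ext ζ
  have h1 := projDiff_tangentChartFrame w₀ hz (ζ 0)
  have h2 := extChartAt_tangent_symm w₀ ((mem_extChartAt_tangent_target w₀).mp hz) z.2
  have h3 : ∀ w w' : TangentBundle 𝓘(ℝ, E) M, w = w' → ∀ u u' : E, u = u' →
      S.m.inner w.proj w.snd u = S.m.inner w'.proj w'.snd u' := by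
    rintro w _ rfl u _ rfl; rfl
  exact h3 _ _ h2 _ _ h1

theorem energy_chart_symm (w₀ : TangentBundle 𝓘(ℝ, E) M) {z : E × E}
    (hz : z ∈ (extChartAt 𝓘(ℝ, E).tangent w₀).target) :
    S.energy ((extChartAt 𝓘(ℝ, E).tangent w₀).symm z) =
      (1 / 2) * S.metric.inChart w₀.proj z.1 z.2 z.2 + S.potentialInChart w₀.proj z.1 := by
  have h2 := extChartAt_tangent_symm w₀ ((mem_extChartAt_tangent_target w₀).mp hz) z.2
  rw [Prod.mk.eta] at h2
  rw [h2]
  rfl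

theorem hasFDerivAt_metric_inChart_apply [FiniteDimensional ℝ E] (x₀ : M) {z : E × E}
    (hz : z.1 ∈ (extChartAt 𝓘(ℝ, E) x₀).target) :
    HasFDerivAt (fun z : E × E => S.metric.inChart x₀ z.1 z.2)
      ((S.metric.inChart x₀ z.1).comp (ContinuousLinearMap.snd ℝ E E) +
        ((fderiv ℝ (S.metric.inChart x₀) z.1).comp (ContinuousLinearMap.fst ℝ E E)).flip z.2) z :=
  hasFDerivAt_fst_apply_snd (F := E →L[ℝ] ℝ) (S.hasFDerivAt_metric_inChart x₀ hz)

theorem exists_hasMFDerivAt_energy [FiniteDimensional ℝ E] (w : TangentBundle 𝓘(ℝ, E) M) :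
    ∃ A : E × E →L[ℝ] ℝ, HasMFDerivAt 𝓘(ℝ, E).tangent 𝓘(ℝ, ℝ) S.energy w
        (A.comp (tangentChartDiff w w)) ∧ ∀ ζ : E × E, A ζ =
      (1 / 2) * fderiv ℝ (S.metric.inChart w.proj) (extChartAt 𝓘(ℝ, E) w.proj w.proj)
          ζ.1 (chartDiff w.proj w.proj w.snd) (chartDiff w.proj w.proj w.snd) +
        S.metric.inChart w.proj (extChartAt 𝓘(ℝ, E) w.proj w.proj)
          (chartDiff w.proj w.proj w.snd) ζ.2 +
        fderiv ℝ (S.potentialInChart w.proj) (extChartAt 𝓘(ℝ, E) w.proj w.proj) ζ.1 := by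
  have hz0 := extChartAt_tangent_apply w (mem_extChartAt_source (I := 𝓘(ℝ, E)) w.proj) w.snd
  have hz : (extChartAt 𝓘(ℝ, E).tangent w w).1 ∈ (extChartAt 𝓘(ℝ, E) w.proj).target :=
    (mem_extChartAt_tangent_target w).mp (mem_extChartAt_target w)
  have h1 := ((((S.hasFDerivAt_metric_inChart_apply w.proj hz).clm_apply hasFDerivAt_snd).const_mul
    (1 / 2 : ℝ)).add ((S.hasFDerivAt_potentialInChart w.proj hz).comp
      (extChartAt 𝓘(ℝ, E).tangent w w) hasFDerivAt_fst)).hasMFDerivAt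
  have h2 := h1.comp w (mdifferentiableAt_tangentChart w).hasMFDerivAt
  have h3 : S.energy =ᶠ[nhds w] (fun z : E × E => (1 / 2) * S.metric.inChart w.proj z.1 z.2 z.2 +
      S.potentialInChart w.proj z.1) ∘ extChartAt 𝓘(ℝ, E).tangent w := by
    filter_upwards [extChartAt_source_mem_nhds (I := 𝓘(ℝ, E).tangent) w] with u hu
    have := S.energy_chart_symm w ((extChartAt 𝓘(ℝ, E).tangent w).map_source hu)
    rw [(extChartAt 𝓘(ℝ, E).tangent w).left_inv hu] at this
    exact this
  refine ⟨_, h2.congr_of_eventuallyEq h3, fun ζ => ?_⟩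
  have hz1 : extChartAt 𝓘(ℝ, E).tangent w w = (extChartAt 𝓘(ℝ, E) w.proj w.proj,
    chartDiff w.proj w.proj w.snd) := hz0
  rw [hz1]
  have h5 : ∀ p p' q r : ℝ, p' = p →
      (1 / 2) * (p + (p' + q)) + r = (1 / 2) * q + p + r := by
    rintro p _ q r rfl; ring
  exact h5 _ _ _ _ (S.metric_inChart_symm w.proj _ ζ.2 (chartDiff w.proj w.proj w.snd))

theorem mdifferentiableAt_energy [FiniteDimensional ℝ E] (w : TangentBundle 𝓘(ℝ, E) M) :
    MDifferentiableAt 𝓘(ℝ, E).tangent 𝓘(ℝ, ℝ) S.energy w := by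
  obtain ⟨A, hA, -⟩ := S.exists_hasMFDerivAt_energy w
  exact hA.mdifferentiableAt

theorem mfderiv_energy_apply [FiniteDimensional ℝ E] (w : TangentBundle 𝓘(ℝ, E) M)
    (Y : TangentSpace 𝓘(ℝ, E).tangent w) :
    (mfderiv 𝓘(ℝ, E).tangent 𝓘(ℝ, ℝ) S.energy w Y : ℝ) =
      (1 / 2) * fderiv ℝ (S.metric.inChart w.proj) (extChartAt 𝓘(ℝ, E) w.proj w.proj)
          (tangentChartDiff w w Y).1 (chartDiff w.proj w.proj w.snd)
          (chartDiff w.proj w.proj w.snd) +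
        S.metric.inChart w.proj (extChartAt 𝓘(ℝ, E) w.proj w.proj)
          (chartDiff w.proj w.proj w.snd) (tangentChartDiff w w Y).2 +
        fderiv ℝ (S.potentialInChart w.proj) (extChartAt 𝓘(ℝ, E) w.proj w.proj)
          (tangentChartDiff w w Y).1 := by
  obtain ⟨A, hA, hA'⟩ := S.exists_hasMFDerivAt_energy w
  exact (congrArg (fun B : TangentSpace 𝓘(ℝ, E).tangent w →L[ℝ] ℝ => B Y) hA.mfderiv).trans
    (hA' (tangentChartDiff w w Y))

theorem lagrangeTwo_apply [FiniteDimensional ℝ E] (w : TangentBundle 𝓘(ℝ, E) M)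
    (Z Y : TangentSpace 𝓘(ℝ, E).tangent w) :
    S.lagrangeTwo w ![Z, Y] =
      fderiv ℝ (S.metric.inChart w.proj) (extChartAt 𝓘(ℝ, E) w.proj w.proj)
          (tangentChartDiff w w Z).1 (chartDiff w.proj w.proj w.snd) (tangentChartDiff w w Y).1 +
        S.metric.inChart w.proj (extChartAt 𝓘(ℝ, E) w.proj w.proj)
          (tangentChartDiff w w Z).2 (tangentChartDiff w w Y).1 -
      (fderiv ℝ (S.metric.inChart w.proj) (extChartAt 𝓘(ℝ, E) w.proj w.proj)
          (tangentChartDiff w w Y).1 (chartDiff w.proj w.proj w.snd) (tangentChartDiff w w Z).1 +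
        S.metric.inChart w.proj (extChartAt 𝓘(ℝ, E) w.proj w.proj)
          (tangentChartDiff w w Y).2 (tangentChartDiff w w Z).1) := by
  have hz0 := extChartAt_tangent_apply w (mem_extChartAt_source (I := 𝓘(ℝ, E)) w.proj) w.snd
  have hz : (extChartAt 𝓘(ℝ, E).tangent w w).1 ∈ (extChartAt 𝓘(ℝ, E) w.proj).target :=
    (mem_extChartAt_tangent_target w).mp (mem_extChartAt_target w)
  have hz1 : extChartAt 𝓘(ℝ, E).tangent w w = (extChartAt 𝓘(ℝ, E) w.proj w.proj,
    chartDiff w.proj w.proj w.snd) := hz0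
  let Λ : (E →L[ℝ] ℝ) →L[ℝ] (E × E) [⋀^Fin 1]→L[ℝ] ℝ :=
    (ContinuousAlternatingMap.ofSubsingletonLIE (𝕜 := ℝ) (E := E × E) (F := ℝ)
      (0 : Fin 1)).toContinuousLinearEquiv.toContinuousLinearMap.comp
      ((ContinuousLinearMap.compL ℝ (E × E) E ℝ).flip (ContinuousLinearMap.fst ℝ E E))
  have h1 : HasFDerivAt (fun z : E × E => Λ (S.metric.inChart w.proj z.1 z.2)) _
      (extChartAt 𝓘(ℝ, E).tangent w w) :=
    Λ.hasFDerivAt.comp _ (S.hasFDerivAt_metric_inChart_apply w.proj hz)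
  have h2 : S.lagrangeOne.inChart w =ᶠ[nhds (extChartAt 𝓘(ℝ, E).tangent w w)]
      fun z => Λ (S.metric.inChart w.proj z.1 z.2) := by
    filter_upwards [extChartAt_target_mem_nhds (I := 𝓘(ℝ, E).tangent) w] with z hz
    exact S.lagrangeOne_inChart w hz
  have h3 := (h1.congr_of_eventuallyEq h2).fderiv
  rw [lagrangeTwo, FormField.extDer, ModelWithCorners.range_eq_univ, extDerivWithin_univ, extDeriv,
    h3]
  change ContinuousAlternatingMap.alternatizeUncurryFin _
    (tangentChartDiff w w ∘ ![Z, Y]) = _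
  rw [ContinuousAlternatingMap.alternatizeUncurryFin_apply, Fin.sum_univ_two, hz1]
  have h4 : ∀ p q r s : ℝ, ((-1 : ℤ) ^ ((0 : Fin 2) : ℕ) • (p + q) : ℝ) +
      (-1 : ℤ) ^ ((1 : Fin 2) : ℕ) • (r + s) = q + p - (s + r) := by
    intros; simp; ring
  exact h4 (S.metric.inChart w.proj _ (tangentChartDiff w w Z).2 (tangentChartDiff w w Y).1)
    (fderiv ℝ (S.metric.inChart w.proj) _ (tangentChartDiff w w Z).1 _ (tangentChartDiff w w Y).1)
    (S.metric.inChart w.proj _ (tangentChartDiff w w Y).2 (tangentChartDiff w w Z).1)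
    (fderiv ℝ (S.metric.inChart w.proj) _ (tangentChartDiff w w Y).1 _ (tangentChartDiff w w Z).1)

end GyroSystem

end Dynamics

section EulerLagrange

variable {E : Type*} [NormedAddCommGroup E] [NormedSpace ℝ E]
  {M : Type*} [TopologicalSpace M] [ChartedSpace E M] [IsManifold 𝓘(ℝ, E) ∞ M]

namespace GyroSystem

variable (S : GyroSystem E M)

/-- The matrix of the metric at the centre of the preferred chart around `x`. -/
def metricAt (x : M) : E →L[ℝ] E →L[ℝ] ℝ :=
  S.metric.inChart x (extChartAt 𝓘(ℝ, E) x x)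

/-- The derivative of the matrix of the metric at the centre of the preferred chart around `x`. -/
def metricDeriv (x : M) : E →L[ℝ] E →L[ℝ] E →L[ℝ] ℝ :=
  fderiv ℝ (S.metric.inChart x) (extChartAt 𝓘(ℝ, E) x x)

/-- The derivative of the potential at the centre of the preferred chart around `x`. -/
def potentialDeriv (x : M) : E →L[ℝ] ℝ :=
  fderiv ℝ (S.potentialInChart x) (extChartAt 𝓘(ℝ, E) x x)

/-- The Lagrange equation at `x`, in the preferred chart around `x`, for the velocity `u` and the
second derivative `b` of the coordinates. -/
def LagrangeEquation (x : M) (u : TangentSpace 𝓘(ℝ, E) x) (b : E) : Prop :=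
  ∀ Y : TangentSpace 𝓘(ℝ, E) x,
    S.metricAt x b (chartDiff x x Y) +
        S.metricDeriv x (chartDiff x x u) (chartDiff x x u) (chartDiff x x Y) -
        (1 / 2) * S.metricDeriv x (chartDiff x x Y) (chartDiff x x u) (chartDiff x x u) +
        S.potentialDeriv x (chartDiff x x Y) = - S.κ x ![u, Y]

theorem metricAt_symm (x : M) (a b : E) : S.metricAt x a b = S.metricAt x b a :=
  S.metric_inChart_symm x _ a b

theorem metricAt_pos (x : M) {a : E} (ha : a ≠ 0) : 0 < S.metricAt x a a :=
  S.metric_inChart_pos (mem_extChartAt_target x) ha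

theorem eq_of_metricAt_eq (x : M) {a b : E} (h : ∀ c, S.metricAt x c a = S.metricAt x c b) :
    a = b := by
  by_contra hab
  have := S.metricAt_pos x (sub_ne_zero.mpr hab)
  rw [map_sub, h, sub_self] at this
  exact lt_irrefl _ this

/-- The differential of the total energy. -/
def energyDiff (w : TangentBundle 𝓘(ℝ, E) M) (Y : TangentSpace 𝓘(ℝ, E).tangent w) : ℝ :=
  mfderiv 𝓘(ℝ, E).tangent 𝓘(ℝ, ℝ) S.energy w Y

theorem energyDiff_apply [FiniteDimensional ℝ E] (w : TangentBundle 𝓘(ℝ, E) M) (Y : TangentSpace 𝓘(ℝ, E).tangent w) :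
    S.energyDiff w Y =
      (1 / 2) * S.metricDeriv w.proj (tangentChartDiff w w Y).1 (chartDiff w.proj w.proj w.snd)
          (chartDiff w.proj w.proj w.snd) +
        S.metricAt w.proj (chartDiff w.proj w.proj w.snd) (tangentChartDiff w w Y).2 +
        S.potentialDeriv w.proj (tangentChartDiff w w Y).1 :=
  S.mfderiv_energy_apply w Y

theorem lagrangeTwo_add_pullback_apply [FiniteDimensional ℝ E] (w : TangentBundle 𝓘(ℝ, E) M)
    (Z Y : TangentSpace 𝓘(ℝ, E).tangent w) :
    (S.lagrangeTwo w + S.pullbackκ w) ![Z, Y] =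
      S.metricDeriv w.proj (tangentChartDiff w w Z).1 (chartDiff w.proj w.proj w.snd)
          (tangentChartDiff w w Y).1 +
        S.metricAt w.proj (tangentChartDiff w w Z).2 (tangentChartDiff w w Y).1 -
      (S.metricDeriv w.proj (tangentChartDiff w w Y).1 (chartDiff w.proj w.proj w.snd)
          (tangentChartDiff w w Z).1 +
        S.metricAt w.proj (tangentChartDiff w w Y).2 (tangentChartDiff w w Z).1) +
      S.κ w.proj ![projDiff w Z, projDiff w Y] := by
  have h1 := S.lagrangeTwo_apply w Z Y
  have h2 : S.pullbackκ w ![Z, Y] = S.κ w.proj ![projDiff w Z, projDiff w Y] := by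
    change S.κ w.proj (projDiff w ∘ ![Z, Y]) = _
    congr 1
    ext i
    fin_cases i <;> rfl
  rw [ContinuousAlternatingMap.add_apply, h2]
  exact congrArg (· + _) h1

theorem exists_projDiff_eq (w : TangentBundle 𝓘(ℝ, E) M) (u : TangentSpace 𝓘(ℝ, E) w.proj)
    (b : E) : ∃ Z : TangentSpace 𝓘(ℝ, E).tangent w,
      projDiff w Z = u ∧ tangentChartDiff w w Z = (chartDiff w.proj w.proj u, b) := by
  obtain ⟨Z, hZ⟩ := exists_tangentChartDiff_eq w (chartDiff w.proj w.proj u, b)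
  refine ⟨Z, chartDiff_injective (mem_extChartAt_source w.proj) ?_, hZ⟩
  rw [chartDiff_projDiff, hZ]

/-- The equation `i_Z (σ + p^* κ) = -d(K + V ∘ p)` in coordinates. -/
theorem dynamical_iff [FiniteDimensional ℝ E] (w : TangentBundle 𝓘(ℝ, E) M) (Z : TangentSpace 𝓘(ℝ, E).tangent w) :
    (∀ Y : TangentSpace 𝓘(ℝ, E).tangent w, (S.lagrangeTwo w + S.pullbackκ w) ![Z, Y] =
      -(mfderiv 𝓘(ℝ, E).tangent 𝓘(ℝ, ℝ) S.energy w Y : ℝ)) ↔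
    (tangentChartDiff w w Z).1 = chartDiff w.proj w.proj w.snd ∧
      S.LagrangeEquation w.proj w.snd (tangentChartDiff w w Z).2 := by
  change (∀ Y, (S.lagrangeTwo w + S.pullbackκ w) ![Z, Y] = -S.energyDiff w Y) ↔ _
  have hproj : (tangentChartDiff w w Z).1 = chartDiff w.proj w.proj w.snd →
      projDiff w Z = w.snd := fun h =>
    chartDiff_injective (mem_extChartAt_source w.proj) (by rw [chartDiff_projDiff, h])
  constructor
  · intro h
    have hfst : (tangentChartDiff w w Z).1 = chartDiff w.proj w.proj w.snd := by
      refine S.eq_of_metricAt_eq w.proj fun c => ?_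
      obtain ⟨Y, hY1, hY⟩ := exists_projDiff_eq w 0 c
      have h0 : S.κ w.proj ![projDiff w Z, 0] = 0 :=
        (S.κ w.proj).map_coord_zero (m := ![projDiff w Z, 0]) 1 rfl
      have := h Y
      rw [S.lagrangeTwo_add_pullback_apply, S.energyDiff_apply, hY, hY1, h0] at this
      simp only [map_zero, zero_apply] at this
      rw [S.metricAt_symm w.proj c (chartDiff w.proj w.proj w.snd)]
      linarith
    refine ⟨hfst, fun U => ?_⟩
    obtain ⟨Y, hY1, hY⟩ := exists_projDiff_eq w U 0
    have := h Y
    rw [S.lagrangeTwo_add_pullback_apply, S.energyDiff_apply, hY, hY1, hproj hfst, hfst] at this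
    simp only [map_zero, zero_apply] at this
    linarith
  · rintro ⟨hfst, hsnd⟩ Y
    have := hsnd (projDiff w Y)
    rw [chartDiff_projDiff] at this
    rw [S.lagrangeTwo_add_pullback_apply, S.energyDiff_apply, hproj hfst, hfst,
      S.metricAt_symm w.proj (tangentChartDiff w w Y).2]
    linarith

theorem exists_lagrangeEquation [FiniteDimensional ℝ E] (x : M) (u : TangentSpace 𝓘(ℝ, E) x) :
    ∃ b, S.LagrangeEquation x u b := by
  obtain ⟨A, hA⟩ := isInvertible_of_pos (S.metricAt x) fun _ => S.metricAt_pos x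
  have hx := mem_extChartAt_source (I := 𝓘(ℝ, E)) x
  let ι : TangentSpace 𝓘(ℝ, E) x ≃ₗ[ℝ] E := LinearEquiv.ofBijective (chartDiff x x).toLinearMap
    ⟨chartDiff_injective hx, exists_chartDiff_eq x⟩
  have hι : ∀ Y, ι.symm (chartDiff x x Y) = Y := fun Y => ι.symm_apply_apply Y
  have up : ∀ b : TangentSpace 𝓘(ℝ, E) x, Function.update ![u, 0] 1 b = ![u, b] := fun b => by
    ext i; fin_cases i <;> rfl
  let κu : E →ₗ[ℝ] ℝ :=
    ((S.κ x).toMultilinearMap.toLinearMap ![u, 0] 1).comp ι.symm.toLinearMap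
  have hκu : ∀ Y, κu (chartDiff x x Y) = S.κ x ![u, Y] := fun Y => by
    change S.κ x (Function.update ![u, 0] 1 (ι.symm (chartDiff x x Y))) = _
    rw [hι, up]
  let v := chartDiff x x u
  let f : E →L[ℝ] ℝ := (1 / 2 : ℝ) • ((S.metricDeriv x).flip v).flip v - S.metricDeriv x v v -
    S.potentialDeriv x - κu.toContinuousLinearMap
  refine ⟨A.symm f, fun Y => ?_⟩
  have h1 : S.metricAt x (A.symm f) = f := by
    rw [← hA]; exact A.apply_symm_apply f
  have h2 : f (chartDiff x x Y) = (1 / 2) * S.metricDeriv x (chartDiff x x Y) v v -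
    S.metricDeriv x v v (chartDiff x x Y) - S.potentialDeriv x (chartDiff x x Y) -
    κu (chartDiff x x Y) := rfl
  rw [h1, h2, hκu]
  ring

/-- The dynamical vector field exists: the form `σ + p^* κ` is nondegenerate. -/
theorem exists_isDynamicalField [FiniteDimensional ℝ E] : ∃ X : ∀ w : TangentBundle 𝓘(ℝ, E) M,
    TangentSpace 𝓘(ℝ, E).tangent w, S.IsDynamicalField X := by
  have h : ∀ w : TangentBundle 𝓘(ℝ, E) M, ∃ Z : TangentSpace 𝓘(ℝ, E).tangent w,
      ∀ Y : TangentSpace 𝓘(ℝ, E).tangent w, (S.lagrangeTwo w + S.pullbackκ w) ![Z, Y] =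
        -(mfderiv 𝓘(ℝ, E).tangent 𝓘(ℝ, ℝ) S.energy w Y : ℝ) := by
    intro w
    obtain ⟨b, hb⟩ := S.exists_lagrangeEquation w.proj w.snd
    obtain ⟨Z, -, hZ⟩ := exists_projDiff_eq w w.snd b
    exact ⟨Z, (S.dynamical_iff w Z).mpr (by rw [hZ]; exact ⟨rfl, hb⟩)⟩
  choose X hX using h
  exact ⟨X, hX⟩

theorem lagrangeEquation_unique {x : M} {u : TangentSpace 𝓘(ℝ, E) x} {a b : E}
    (ha : S.LagrangeEquation x u a) (hb : S.LagrangeEquation x u b) : a = b := by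
  refine S.eq_of_metricAt_eq x fun c => ?_
  obtain ⟨Y, rfl⟩ := exists_chartDiff_eq x c
  rw [S.metricAt_symm x _ a, S.metricAt_symm x _ b]
  linarith [ha Y, hb Y]

end GyroSystem

end EulerLagrange

section Curves

open Filter Topology

variable {E : Type*} [NormedAddCommGroup E] [NormedSpace ℝ E]
  {M : Type*} [TopologicalSpace M] [ChartedSpace E M] [IsManifold 𝓘(ℝ, E) ∞ M]

/-- The coordinates of a curve in the preferred chart around `x₀`. -/
def coordCurve (x₀ : M) (γ : ℝ → M) (s : ℝ) : E := extChartAt 𝓘(ℝ, E) x₀ (γ s)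

theorem hasDerivAt_of_hasMFDerivAt {F : Type*} [NormedAddCommGroup F] [NormedSpace ℝ F] {f : ℝ → F}
    {f' : ℝ →L[ℝ] F} {t : ℝ} (h : HasMFDerivAt 𝓘(ℝ, ℝ) 𝓘(ℝ, F) f t f') :
    HasDerivAt f (f' 1) t := by
  have h' : HasFDerivAt f f' t := hasMFDerivAt_iff_hasFDerivAt.mp h
  exact h'.hasDerivAt

theorem hasDerivAt_coordCurve {x₀ : M} {γ : ℝ → M} {t : ℝ}
    (hγ : MDifferentiableAt 𝓘(ℝ, ℝ) 𝓘(ℝ, E) γ t)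
    (ht : γ t ∈ (extChartAt 𝓘(ℝ, E) x₀).source) :
    HasDerivAt (coordCurve (E := E) x₀ γ) (chartDiff x₀ (γ t) (velocity γ t)) t :=
  hasDerivAt_of_hasMFDerivAt
    ((mdifferentiableAt_chart ht).hasMFDerivAt.comp t hγ.hasMFDerivAt)

theorem contDiffAt_coordCurve {x₀ : M} {γ : ℝ → M} {t : ℝ}
    (hγ : ContMDiffAt 𝓘(ℝ, ℝ) 𝓘(ℝ, E) 2 γ t)
    (ht : γ t ∈ (extChartAt 𝓘(ℝ, E) x₀).source) :
    ContDiffAt ℝ 2 (coordCurve (E := E) x₀ γ) t := by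
  rw [← contMDiffAt_iff_contDiffAt]
  exact (contMDiffAt_extChartAt' (by rwa [← extChartAt_source 𝓘(ℝ, E)])).comp t hγ

theorem eventually_hasDerivAt_coordCurve {x₀ : M} {γ : ℝ → M} {t : ℝ}
    (hγ : ContMDiffAt 𝓘(ℝ, ℝ) 𝓘(ℝ, E) 2 γ t)
    (ht : γ t ∈ (extChartAt 𝓘(ℝ, E) x₀).source) :
    ∀ᶠ s in 𝓝 t, γ s ∈ (extChartAt 𝓘(ℝ, E) x₀).source ∧
      HasDerivAt (coordCurve (E := E) x₀ γ) (chartDiff x₀ (γ s) (velocity γ s)) s := by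
  filter_upwards [contMDiffAt_iff_contMDiffAt_nhds (by simp) |>.mp hγ, hγ.continuousAt.preimage_mem_nhds
    ((isOpen_extChartAt_source x₀).mem_nhds ht)] with s hs hs'
  exact ⟨hs', hasDerivAt_coordCurve (hs.mdifferentiableAt (by simp)) hs'⟩

theorem hasDerivAt_deriv_coordCurve {x₀ : M} {γ : ℝ → M} {t : ℝ}
    (hγ : ContMDiffAt 𝓘(ℝ, ℝ) 𝓘(ℝ, E) 2 γ t)
    (ht : γ t ∈ (extChartAt 𝓘(ℝ, E) x₀).source) :
    HasDerivAt (deriv (coordCurve (E := E) x₀ γ)) (deriv (deriv (coordCurve (E := E) x₀ γ)) t) t := by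
  have h : ContDiffAt ℝ 1 (deriv (coordCurve (E := E) x₀ γ)) t :=
    (contDiffAt_coordCurve hγ ht).derivWithin (by norm_num)
  exact (h.differentiableAt (by simp)).hasDerivAt

theorem hasDerivAt_tangentChart {w : ℝ → TangentBundle 𝓘(ℝ, E) M} {t : ℝ}
    {Z : TangentSpace 𝓘(ℝ, E).tangent (w t)}
    (h : HasMFDerivAt 𝓘(ℝ, ℝ) 𝓘(ℝ, E).tangent w t ((1 : ℝ →L[ℝ] ℝ).smulRight Z)) :
    HasDerivAt (fun s => extChartAt 𝓘(ℝ, E).tangent (w t) (w s))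
      (tangentChartDiff (w t) (w t) Z) t := by
  have h1 := hasDerivAt_of_hasMFDerivAt
    ((mdifferentiableAt_tangentChart (w t)).hasMFDerivAt.comp t h)
  convert! h1 using 1
  change _ = tangentChartDiff (w t) (w t) ((1 : ℝ) • Z)
  rw [one_smul]

theorem hasMFDerivAt_of_tangentChart {w : ℝ → TangentBundle 𝓘(ℝ, E) M} {t : ℝ}
    {Z : TangentSpace 𝓘(ℝ, E).tangent (w t)}
    (hs : ∀ᶠ s in 𝓝 t, w s ∈ (extChartAt 𝓘(ℝ, E).tangent (w t)).source)
    (h : HasDerivAt (fun s => extChartAt 𝓘(ℝ, E).tangent (w t) (w s))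
      (tangentChartDiff (w t) (w t) Z) t) :
    HasMFDerivAt 𝓘(ℝ, ℝ) 𝓘(ℝ, E).tangent w t ((1 : ℝ →L[ℝ] ℝ).smulRight Z) := by
  have h1 : HasMFDerivAt 𝓘(ℝ, E × E) 𝓘(ℝ, E).tangent (extChartAt 𝓘(ℝ, E).tangent (w t)).symm
      (extChartAt 𝓘(ℝ, E).tangent (w t) (w t))
      (tangentChartFrame (w t) (extChartAt 𝓘(ℝ, E).tangent (w t) (w t))) := by
    rw [tangentChartFrame_eq_mfderiv]
    exact (mdifferentiableAt_tangentChart_symm _ (mem_extChartAt_target _)).hasMFDerivAt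
  have h2 := (h1.comp t h.hasFDerivAt.hasMFDerivAt).congr_of_eventuallyEq (f₁ := w)
    (hs.mono fun s hs => ((extChartAt 𝓘(ℝ, E).tangent (w t)).left_inv hs).symm)
  have h3 : ((1 : ℝ →L[ℝ] ℝ).smulRight (Z : E × E)) =
      (tangentChartFrame (w t) (extChartAt 𝓘(ℝ, E).tangent (w t) (w t)) : E × E →L[ℝ] E × E).comp
        (ContinuousLinearMap.toSpanSingleton ℝ (tangentChartDiff (w t) (w t) Z)) := by
    ext1
    have h4 := tangentChartFrame_tangentChartDiff (mem_extChartAt_source (w t)) Z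
    change (1 : ℝ) • (Z : E × E) =
      (tangentChartFrame (w t) (extChartAt 𝓘(ℝ, E).tangent (w t) (w t)) : E × E →L[ℝ] E × E)
        ((1 : ℝ) • tangentChartDiff (w t) (w t) Z)
    rw [one_smul, one_smul]
    exact h4.symm
  exact h3 ▸ h2

/-- The lift of a curve to the tangent bundle. -/
def lift (γ : ℝ → M) (s : ℝ) : TangentBundle 𝓘(ℝ, E) M := ⟨γ s, velocity γ s⟩

omit [IsManifold 𝓘(ℝ, E) ∞ M] in
theorem lift_congr {x₁ x₂ : ℝ → M} {t : ℝ} (h : x₁ =ᶠ[𝓝 t] x₂) :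
    lift (E := E) x₁ t = lift x₂ t := by
  have h2 : ∀ A B : ℝ →L[ℝ] E, A = B → A 1 = B 1 := fun A B hAB => by rw [hAB]
  have h1 : (velocity x₁ t : E) = velocity x₂ t :=
    h2 _ _ (h.mfderiv_eq (I := 𝓘(ℝ, ℝ)) (I' := 𝓘(ℝ, E)))
  exact Bundle.TotalSpace.ext h.eq_of_nhds (heq_of_eq h1)

theorem extChartAt_lift {x₀ : M} {u : TangentSpace 𝓘(ℝ, E) x₀} {γ : ℝ → M} {t : ℝ}
    (hγ : ContMDiffAt 𝓘(ℝ, ℝ) 𝓘(ℝ, E) 2 γ t)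
    (ht : γ t ∈ (extChartAt 𝓘(ℝ, E) x₀).source) :
    ∀ᶠ s in 𝓝 t, extChartAt 𝓘(ℝ, E).tangent (⟨x₀, u⟩ : TangentBundle 𝓘(ℝ, E) M) (lift γ s) =
      (coordCurve x₀ γ s, deriv (coordCurve (E := E) x₀ γ) s) := by
  filter_upwards [eventually_hasDerivAt_coordCurve hγ ht] with s hs
  rw [hs.2.deriv]
  exact extChartAt_tangent_apply ⟨x₀, u⟩ hs.1 _

theorem hasMFDerivAt_lift {γ : ℝ → M} {t : ℝ} (hγ : ContMDiffAt 𝓘(ℝ, ℝ) 𝓘(ℝ, E) 2 γ t)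
    {Z : TangentSpace 𝓘(ℝ, E).tangent (lift γ t)}
    (hZ : tangentChartDiff (lift γ t) (lift γ t) Z =
      (chartDiff (E := E) (γ t) (γ t) (velocity γ t),
        deriv (deriv (coordCurve (E := E) (γ t) γ)) t)) :
    HasMFDerivAt 𝓘(ℝ, ℝ) 𝓘(ℝ, E).tangent (lift γ) t ((1 : ℝ →L[ℝ] ℝ).smulRight Z) := by
  have hs := mem_extChartAt_source (I := 𝓘(ℝ, E)) (γ t)
  have h1 := hasDerivAt_coordCurve (hγ.mdifferentiableAt (by simp)) hs
  have h2 : HasDerivAt (fun s => (coordCurve (γ t) γ s, deriv (coordCurve (E := E) (γ t) γ) s))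
      (tangentChartDiff (lift γ t) (lift γ t) Z) t := by
    rw [hZ]
    exact h1.prodMk (hasDerivAt_deriv_coordCurve hγ hs)
  refine hasMFDerivAt_of_tangentChart ?_ ?_
  · filter_upwards [eventually_hasDerivAt_coordCurve hγ hs] with s hs'
    rw [extChartAt_tangent_source]
    exact hs'.1
  · exact h2.congr_of_eventuallyEq (extChartAt_lift (u := velocity γ t) hγ hs)

namespace GyroSystem

variable (S : GyroSystem E M) [FiniteDimensional ℝ E]

theorem isMotionOn_iff {x : ℝ → M} {J : Set ℝ} (hJ : IsOpen J)
    (hx : ContMDiffOn 𝓘(ℝ, ℝ) 𝓘(ℝ, E) 2 x J) :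
    S.IsMotionOn x J ↔ ∀ t ∈ J, S.LagrangeEquation (x t) (velocity x t)
      (deriv (deriv (coordCurve (E := E) (x t) x)) t) := by
  have hxt : ∀ t ∈ J, ContMDiffAt 𝓘(ℝ, ℝ) 𝓘(ℝ, E) 2 x t := fun t ht =>
    hx.contMDiffAt (hJ.mem_nhds ht)
  constructor
  · rintro ⟨X, hX, w, hw, hwx⟩
    have hder : ∀ t ∈ J, HasDerivAt (fun s => extChartAt 𝓘(ℝ, E).tangent (w t) (w s))
        (tangentChartDiff (w t) (w t) (X (w t))) t := fun t ht =>
      hasDerivAt_tangentChart ((hw t ht).hasMFDerivAt (hJ.mem_nhds ht))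
    have hdyn := fun t => (S.dynamical_iff (w t) (X (w t))).mp (hX (w t))
    have hproj : ∀ t ∈ J, ∀ᶠ s in 𝓝 t, (extChartAt 𝓘(ℝ, E).tangent (w t) (w s)).1 =
        coordCurve (w t).proj x s := by
      intro t ht
      filter_upwards [hJ.mem_nhds ht, (hw t ht).continuousWithinAt.continuousAt
        (hJ.mem_nhds ht) |>.preimage_mem_nhds
        (extChartAt_source_mem_nhds (I := 𝓘(ℝ, E).tangent) (w t))] with s hs hs'
      rw [mem_preimage, extChartAt_tangent_source] at hs'
      have := extChartAt_tangent_apply (w t) hs' (w s).snd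
      rw [coordCurve, hwx s hs]
      exact congrArg Prod.fst this
    have hlift : ∀ t ∈ J, w t = lift x t := by
      intro t ht
      have h1 : HasDerivAt (coordCurve (w t).proj x)
          (tangentChartDiff (w t) (w t) (X (w t))).1 t :=
        HasDerivAt.congr_of_eventuallyEq
          ((ContinuousLinearMap.fst ℝ E E).hasFDerivAt.comp_hasDerivAt t (hder t ht)) ((hproj t ht).mono fun s hs => hs.symm)
      rw [(hdyn t).1] at h1
      have hs : x t ∈ (extChartAt 𝓘(ℝ, E) (w t).proj).source := by
        rw [hwx t ht]; exact mem_extChartAt_source _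
      have h2 := hasDerivAt_coordCurve ((hxt t ht).mdifferentiableAt (by simp)) hs
      have h3 := h2.unique h1
      apply (extChartAt 𝓘(ℝ, E).tangent (w t)).injOn (mem_extChartAt_source _)
      · rw [extChartAt_tangent_source]; exact hs
      · rw [lift, extChartAt_tangent_apply (w t) hs, h3, hwx t ht]
        exact extChartAt_tangent_apply (w t) (mem_extChartAt_source _) (w t).snd
    intro t ht
    have hs : x t ∈ (extChartAt 𝓘(ℝ, E) (w t).proj).source := by
      rw [hwx t ht]; exact mem_extChartAt_source _
    have h1 : HasDerivAt (deriv (coordCurve (w t).proj x))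
        (tangentChartDiff (w t) (w t) (X (w t))).2 t := by
      refine HasDerivAt.congr_of_eventuallyEq
        ((ContinuousLinearMap.snd ℝ E E).hasFDerivAt.comp_hasDerivAt t (hder t ht)) ?_
      filter_upwards [hJ.mem_nhds ht, extChartAt_lift (u := (w t).snd) (hxt t ht) hs] with s hs hs'
      change _ = (extChartAt 𝓘(ℝ, E).tangent (w t) (w s)).2
      rw [hlift s hs]
      exact (congrArg Prod.snd hs').symm
    have h2 := (hdyn t).2
    rw [← h1.deriv, hlift t ht] at h2
    exact h2
  · intro h
    obtain ⟨X, hX⟩ := S.exists_isDynamicalField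
    refine ⟨X, hX, lift x, fun t ht => ?_, fun t _ => rfl⟩
    have hs := mem_extChartAt_source (I := 𝓘(ℝ, E)) (x t)
    obtain ⟨h1, h2⟩ := (S.dynamical_iff (lift x t) (X (lift x t))).mp (hX (lift x t))
    have h3 := S.lagrangeEquation_unique h2 (h t ht)
    exact (hasMFDerivAt_lift (hxt t ht) (Prod.ext h1 h3)).hasMFDerivWithinAt

end GyroSystem

end Curves

section Reparametrization

open Filter Topology

/-- A real function with a continuous nonvanishing derivative has a differentiable local inverse. -/
theorem exists_local_inverse {s f : ℝ → ℝ} {t : ℝ} (hs : ∀ᶠ a in 𝓝 t, HasDerivAt s (f a) a)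
    (hf : ContinuousAt f t) (hf0 : ∀ᶠ a in 𝓝 t, f a ≠ 0) :
    ∃ r : ℝ → ℝ, r (s t) = t ∧ ContinuousAt r (s t) ∧
      ∀ᶠ σ in 𝓝 (s t), s (r σ) = σ ∧ HasDerivAt r (f (r σ))⁻¹ σ := by
  have h := (hasStrictDerivAt_of_hasDerivAt_of_continuousAt hs hf).hasStrictFDerivAt_equiv
    hf0.self_of_nhds
  let e := h.toOpenPartialHomeomorph s
  have he : (e : ℝ → ℝ) = s := h.toOpenPartialHomeomorph_coe
  have hsrc : t ∈ e.source := h.mem_toOpenPartialHomeomorph_source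
  have htgt : s t ∈ e.target := h.image_mem_toOpenPartialHomeomorph_target
  have hrt : e.symm (s t) = t := by rw [← he]; exact e.left_inv hsrc
  have hc : ContinuousAt e.symm (s t) := e.symm.continuousAt htgt
  refine ⟨e.symm, hrt, hc, ?_⟩
  have hc' : Tendsto e.symm (𝓝 (s t)) (𝓝 t) := by
    have := hc.tendsto
    rwa [hrt] at this
  filter_upwards [e.open_target.mem_nhds htgt, hc'.eventually hs, hc'.eventually hf0]
    with σ h1 h2 h3
  refine ⟨by rw [← he]; exact e.right_inv h1, e.hasDerivAt_symm h1 h3 (by rw [he]; exact h2)⟩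

/-- The second derivative after a change of parameter. -/
theorem hasDerivAt_reparam {E : Type*} [NormedAddCommGroup E] [NormedSpace ℝ E] {v : ℝ → E}
    {f r : ℝ → ℝ} {τ f₁ : ℝ} {b : E} (hf : HasDerivAt f f₁ (r τ)) (hf0 : f (r τ) ≠ 0)
    (hv : HasDerivAt v b (r τ)) (hr : HasDerivAt r (f (r τ))⁻¹ τ) :
    HasDerivAt (fun σ => (f (r σ))⁻¹ • v (r σ))
      ((f (r τ))⁻¹ • ((f (r τ))⁻¹ • b + (-f₁ / f (r τ) ^ 2) • v (r τ))) τ :=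
  ((hf.fun_inv hf0).fun_smul hv).scomp τ hr

/-- An antiderivative of a continuous function on an open interval. -/
theorem exists_hasDerivAt_of_continuousOn {J : Set ℝ} (hJ : IsOpen J) (hJc : J.OrdConnected)
    {f : ℝ → ℝ} (hf : ContinuousOn f J) : ∃ s : ℝ → ℝ, ∀ t ∈ J, HasDerivAt s (f t) t := by
  rcases J.eq_empty_or_nonempty with rfl | ⟨t₀, ht₀⟩
  · exact ⟨0, fun t ht => ht.elim⟩
  · refine ⟨fun t => ∫ a in t₀..t, f a, fun t ht => ?_⟩
    exact intervalIntegral.integral_hasDerivAt_right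
      ((hf.mono (hJc.uIcc_subset ht₀ ht)).intervalIntegrable)
      (hf.stronglyMeasurableAtFilter hJ t ht) (hf.continuousAt (hJ.mem_nhds ht))

end Reparametrization

section Curvature

open Filter Topology

variable {E : Type*} [NormedAddCommGroup E] [NormedSpace ℝ E]
  {M : Type*} [TopologicalSpace M] [ChartedSpace E M] [IsManifold 𝓘(ℝ, E) ∞ M]

theorem chartDiff_chartFrame_self (x : M) (v : E) :
    chartDiff x x (chartFrame x (extChartAt 𝓘(ℝ, E) x x) v : E) = v := by
  have h := chartDiff_chartFrame (mem_extChartAt_target (I := 𝓘(ℝ, E)) x) v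
  have h1 : ∀ p : M, p = x → ∀ u : E, chartDiff x p u = v → chartDiff x x u = v := by
    rintro p rfl u hu; exact hu
  exact h1 _ (extChartAt_to_inv x) _ h

theorem hasFDerivAt_real_smul {F : Type*} [NormedAddCommGroup F] [NormedSpace ℝ F] {c : E → ℝ}
    {c' : E →L[ℝ] ℝ} {f : E → F} {f' : E →L[ℝ] F} {x : E} (hc : HasFDerivAt c c' x)
    (hf : HasFDerivAt f f' x) :
    HasFDerivAt (fun y => c y • f y) (c x • f' + c'.smulRight (f x)) x :=
  hc.fun_smul hf

/-- The coordinates of the curvature vector. -/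
theorem chartDiff_curvatureVector (g : BilinField E M) {γ : ℝ → M} {τ : ℝ}
    (hγ : ∀ᶠ σ in 𝓝 τ, HasDerivAt (coordCurve (E := E) (γ τ) γ)
      (chartDiff (γ τ) (γ σ) (velocity γ σ)) σ) :
    chartDiff (γ τ) (γ τ) (g.curvatureVector γ τ) =
      deriv (deriv (coordCurve (E := E) (γ τ) γ)) τ +
        g.christoffel (γ τ) (extChartAt 𝓘(ℝ, E) (γ τ) (γ τ))
          (deriv (coordCurve (E := E) (γ τ) γ) τ) (deriv (coordCurve (E := E) (γ τ) γ) τ) := by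
  have h1 : (fun σ => chartDiff (γ τ) (γ σ) (velocity γ σ)) =ᶠ[𝓝 τ]
      deriv (coordCurve (E := E) (γ τ) γ) := hγ.mono fun σ hσ => hσ.deriv.symm
  have h2 : chartDiff (γ τ) (γ τ) (velocity γ τ) = deriv (coordCurve (E := E) (γ τ) γ) τ :=
    h1.self_of_nhds
  have h3 : chartDiff (γ τ) (γ τ) (g.curvatureVector γ τ) =
      deriv (fun σ => chartDiff (γ τ) (γ σ) (velocity γ σ)) τ +
        g.christoffel (γ τ) (extChartAt 𝓘(ℝ, E) (γ τ) (γ τ))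
          (deriv (coordCurve (E := E) (γ τ) γ) τ) (chartDiff (γ τ) (γ τ) (velocity γ τ)) :=
    chartDiff_chartFrame_self (γ τ) _
  rw [h3, h1.deriv_eq, h2]

omit [IsManifold 𝓘(ℝ, E) ∞ M] in
theorem BilinField.inChart_christoffel (g : BilinField E M) (x : M) (y u w : E)
    (hg : (g.inChart x y).IsInvertible) :
    g.inChart x y (g.christoffel x y u u) w =
      fderiv ℝ (g.inChart x) y u u w - (1 / 2) * fderiv ℝ (g.inChart x) y w u u := by
  obtain ⟨A, hA⟩ := hg
  have h1 : g.inChart x y (g.christoffel x y u u) = g.christoffelFirst x y u u := by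
    rw [BilinField.christoffel, ← hA, ContinuousLinearMap.inverse_equiv]
    exact A.apply_symm_apply _
  rw [h1]
  have h2 : ∀ a b : ℝ, (1 / 2) * (a + a - b) = a - (1 / 2) * b := by intros; ring
  exact h2 (fderiv ℝ (g.inChart x) y u u w) (fderiv ℝ (g.inChart x) y w u u)

namespace GyroSystem

variable (S : GyroSystem E M)

theorem jacobiMetric_inChart (h : ℝ) (x : M) :
    (S.jacobiMetric h).inChart x =
      fun y => (2 * (h - S.potentialInChart x y)) • S.metric.inChart x y := by
  funext y
  ext u v
  rfl

theorem fderiv_jacobiMetric_inChart [FiniteDimensional ℝ E] (h : ℝ) (x : M) (a u v : E) :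
    fderiv ℝ ((S.jacobiMetric h).inChart x) (extChartAt 𝓘(ℝ, E) x x) a u v =
      2 * (h - S.V x) * S.metricDeriv x a u v - 2 * S.potentialDeriv x a * S.metricAt x u v := by
  have hx := mem_extChartAt_target (I := 𝓘(ℝ, E)) x
  have h0 : HasFDerivAt (fun y => 2 * (h - S.potentialInChart x y))
      ((2 : ℝ) • -fderiv ℝ (S.potentialInChart x) (extChartAt 𝓘(ℝ, E) x x))
      (extChartAt 𝓘(ℝ, E) x x) := ((S.hasFDerivAt_potentialInChart x hx).const_sub h).const_mul 2
  have h1 := (hasFDerivAt_real_smul (F := E →L[ℝ] E →L[ℝ] ℝ) h0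
    (S.hasFDerivAt_metric_inChart x hx)).fderiv
  rw [S.jacobiMetric_inChart, h1]
  have h2 : S.potentialInChart x (extChartAt 𝓘(ℝ, E) x x) = S.V x := by
    rw [potentialInChart, extChartAt_to_inv]
  rw [h2]
  have h3 : ∀ p q r : ℝ, p + (2 * -q) * r = p - 2 * q * r := by intros; ring
  exact h3 _ _ _

end GyroSystem

end Curvature

namespace GyroSystem

open Filter Topology

variable {E : Type*} [NormedAddCommGroup E] [NormedSpace ℝ E]
  {M : Type*} [TopologicalSpace M] [ChartedSpace E M] [IsManifold 𝓘(ℝ, E) ∞ M]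
  (S : GyroSystem E M)

/-- The left-hand side of the Lagrange equation: the covector `D_t x' + dV` in the preferred chart
around `x`, for the velocity `v` and the second derivative `b` of the coordinates. -/
def lagrangeCovector (x : M) (v b c : E) : ℝ :=
  S.metricAt x b c + S.metricDeriv x v v c - (1 / 2) * S.metricDeriv x c v v +
    S.potentialDeriv x c

theorem lagrangeEquation_iff (x : M) (u : TangentSpace 𝓘(ℝ, E) x) (b : E) :
    S.LagrangeEquation x u b ↔ ∀ Y : TangentSpace 𝓘(ℝ, E) x,
      S.lagrangeCovector x (chartDiff x x u) b (chartDiff x x Y) = - S.κ x ![u, Y] := Iff.rfl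

theorem jacobiMetric_inChart_apply (h : ℝ) (x : M) (a c : E) :
    (S.jacobiMetric h).inChart x (extChartAt 𝓘(ℝ, E) x x) a c =
      2 * (h - S.V x) * S.metricAt x a c := by
  have h2 : S.potentialInChart x (extChartAt 𝓘(ℝ, E) x x) = S.V x := by
    rw [potentialInChart, extChartAt_to_inv]
  rw [← h2, S.jacobiMetric_inChart]
  rfl

theorem jacobiMetric_apply (h : ℝ) (x : M) (u Y : TangentSpace 𝓘(ℝ, E) x) :
    S.jacobiMetric h x u Y =
      2 * (h - S.V x) * S.metricAt x (chartDiff x x u) (chartDiff x x Y) := by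
  rw [← S.jacobiMetric_inChart_apply, chartFrame_chartDiff_inner]

theorem jacobiMetric_symm (h : ℝ) (x : M) (u Y : TangentSpace 𝓘(ℝ, E) x) :
    S.jacobiMetric h x u Y = S.jacobiMetric h x Y u := by
  rw [S.jacobiMetric_apply, S.jacobiMetric_apply, S.metricAt_symm]

theorem jacobiMetric_pos {h : ℝ} {x : M} (hx : x ∈ S.region h) {u : TangentSpace 𝓘(ℝ, E) x}
    (hu : u ≠ 0) : 0 < S.jacobiMetric h x u u := by
  have h1 : S.V x < h := hx
  rw [S.jacobiMetric_apply]
  refine mul_pos (by linarith) (S.metricAt_pos x fun h0 => hu ?_)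
  exact chartDiff_injective (mem_extChartAt_source x) (by rw [h0, map_zero])

/-- The curvature vector in the Jacobi metric of a curve `γ`, which in coordinates has the
first two derivatives of a reparametrization, by Jacobi arclength, of a curve with velocity `v` and
second derivative `b`. -/
theorem jacobiMetric_curvatureVector [FiniteDimensional ℝ E] {h : ℝ} {γ : ℝ → M} {τ f : ℝ}
    {v b : E} (hγ : ∀ᶠ σ in 𝓝 τ, HasDerivAt (coordCurve (E := E) (γ τ) γ)
      (chartDiff (γ τ) (γ σ) (velocity γ σ)) σ)
    (hf : 2 * (h - S.V (γ τ)) = f) (hf0 : 0 < f) (hv : S.metricAt (γ τ) v v = f)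
    (hQ1 : deriv (coordCurve (E := E) (γ τ) γ) τ = f⁻¹ • v)
    (hQ2 : deriv (deriv (coordCurve (E := E) (γ τ) γ)) τ =
      f⁻¹ • (f⁻¹ • b + (-(-2 * S.potentialDeriv (γ τ) v) / f ^ 2) • v))
    (Y : TangentSpace 𝓘(ℝ, E) (γ τ)) :
    S.jacobiMetric h (γ τ) ((S.jacobiMetric h).curvatureVector γ τ) Y =
      f⁻¹ * S.lagrangeCovector (γ τ) v b (chartDiff (γ τ) (γ τ) Y) := by
  set c := chartDiff (γ τ) (γ τ) Y
  have hinv : ((S.jacobiMetric h).inChart (γ τ)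
      (extChartAt 𝓘(ℝ, E) (γ τ) (γ τ))).IsInvertible := by
    refine isInvertible_of_pos _ fun a ha => ?_
    rw [S.jacobiMetric_inChart_apply, hf]
    exact mul_pos hf0 (S.metricAt_pos _ ha)
  rw [← chartFrame_chartDiff_inner, chartDiff_curvatureVector _ hγ, hQ1, hQ2, map_add, add_apply,
    BilinField.inChart_christoffel _ _ _ _ _ hinv, S.jacobiMetric_inChart_apply,
    S.fderiv_jacobiMetric_inChart, S.fderiv_jacobiMetric_inChart, hf, lagrangeCovector]
  simp only [map_add, map_smul, add_apply, smul_apply, smul_eq_mul]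
  rw [hv]
  field_simp
  ring

theorem metricAt_velocity {h : ℝ} {x : M} {u : TangentSpace 𝓘(ℝ, E) x}
    (hu : S.energy ⟨x, u⟩ = h) :
    S.metricAt x (chartDiff x x u) (chartDiff x x u) = 2 * (h - S.V x) := by
  have h1 : S.metricAt x (chartDiff x x u) (chartDiff x x u) = S.m.inner x u u :=
    chartFrame_chartDiff_inner (g := S.metric) x u u
  have h2 : (1 / 2) * S.m.inner x u u + S.V x = h := hu
  rw [h1]
  linarith

theorem jacobiMetric_norm_velocity {h : ℝ} {x : M} (hx : x ∈ S.region h)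
    {u : TangentSpace 𝓘(ℝ, E) x} (hu : S.energy ⟨x, u⟩ = h) :
    (S.jacobiMetric h).norm u = 2 * (h - S.V x) := by
  have h1 : S.V x < h := hx
  rw [BilinField.norm, S.jacobiMetric_apply, S.metricAt_velocity hu]
  exact Real.sqrt_mul_self (by linarith)

/-- Conservation of energy, in coordinates. -/
theorem lagrangeCovector_velocity [FiniteDimensional ℝ E] {h : ℝ} {x : ℝ → M} {t : ℝ}
    (hx : ContMDiffAt 𝓘(ℝ, ℝ) 𝓘(ℝ, E) 2 x t)
    (hE : ∀ᶠ a in 𝓝 t, S.energy ⟨x a, velocity x a⟩ = h) :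
    S.lagrangeCovector (x t) (chartDiff (x t) (x t) (velocity x t))
      (deriv (deriv (coordCurve (E := E) (x t) x)) t)
      (chartDiff (x t) (x t) (velocity x t)) = 0 := by
  have hs := mem_extChartAt_source (I := 𝓘(ℝ, E)) (x t)
  obtain ⟨Z, -, hZ⟩ := exists_projDiff_eq (lift x t) (velocity x t)
    (deriv (deriv (coordCurve (E := E) (x t) x)) t)
  have h1 : HasMFDerivAt 𝓘(ℝ, ℝ) 𝓘(ℝ, E).tangent (lift x) t ((1 : ℝ →L[ℝ] ℝ).smulRight Z) :=
    hasMFDerivAt_lift hx hZ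
  have h2 := hasDerivAt_of_hasMFDerivAt
    ((S.mdifferentiableAt_energy (lift x t)).hasMFDerivAt.comp t h1)
  have h3 : HasDerivAt (S.energy ∘ lift x) 0 t :=
    (hasDerivAt_const t h).congr_of_eventuallyEq hE
  have h4 : S.energyDiff (lift x t) ((1 : ℝ) • Z) = 0 := h2.unique h3
  rw [one_smul, S.energyDiff_apply, hZ] at h4
  have h5 := S.metricAt_symm (x t) (deriv (deriv (coordCurve (E := E) (x t) x)) t)
    (chartDiff (x t) (x t) (velocity x t))
  rw [lagrangeCovector, h5]
  have h6 : ∀ p q r : ℝ, (1 / 2) * q + p + r = 0 → p + q - (1 / 2) * q + r = 0 := by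
    intros; linarith
  exact h6 _ _ _ h4

/-- The derivative of the conformal factor of the Jacobi metric along a curve. -/
theorem hasDerivAt_conformalFactor (h : ℝ) {x : ℝ → M} {t : ℝ}
    (hx : MDifferentiableAt 𝓘(ℝ, ℝ) 𝓘(ℝ, E) x t) :
    HasDerivAt (fun a => 2 * (h - S.V (x a)))
      (-2 * S.potentialDeriv (x t) (chartDiff (x t) (x t) (velocity x t))) t := by
  have hs := mem_extChartAt_source (I := 𝓘(ℝ, E)) (x t)
  have h1 : HasDerivAt (S.potentialInChart (x t) ∘ coordCurve (E := E) (x t) x)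
      (S.potentialDeriv (x t) (chartDiff (x t) (x t) (velocity x t))) t :=
    (S.hasFDerivAt_potentialInChart (x t) (mem_extChartAt_target (x t))).comp_hasDerivAt t
      (hasDerivAt_coordCurve hx hs)
  have h2 : (fun a => S.V (x a)) =ᶠ[𝓝 t]
      S.potentialInChart (x t) ∘ coordCurve (E := E) (x t) x := by
    filter_upwards [hx.continuousAt.preimage_mem_nhds
      ((isOpen_extChartAt_source (x t)).mem_nhds hs)] with a ha
    exact congrArg S.V ((extChartAt 𝓘(ℝ, E) (x t)).left_inv ha).symm
  have h3 := ((h1.congr_of_eventuallyEq h2).const_sub h).const_mul 2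
  convert! h3 using 1
  ring

end GyroSystem

namespace GyroSystem

open Filter Topology

variable {E : Type*} [NormedAddCommGroup E] [NormedSpace ℝ E]
  {M : Type*} [TopologicalSpace M] [ChartedSpace E M] [IsManifold 𝓘(ℝ, E) ∞ M]

variable (S : GyroSystem E M)

theorem lagrangeCovector_smul (x : M) (v b c : E) (r : ℝ) :
    S.lagrangeCovector x v b (r • c) = r * S.lagrangeCovector x v b c := by
  simp only [lagrangeCovector, map_smul, smul_apply, smul_eq_mul]
  ring

/-- The coordinates of the reparametrization by Jacobi arclength, up to second order. -/
theorem arclength_reparam [FiniteDimensional ℝ E] {h : ℝ} {y : ℝ → M} {s : ℝ → ℝ} {t : ℝ}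
    (hx : ContMDiffAt 𝓘(ℝ, ℝ) 𝓘(ℝ, E) 2 (y ∘ s) t)
    (hs : ∀ᶠ a in 𝓝 t, HasDerivAt s (2 * (h - S.V (y (s a)))) a)
    (hpos : ∀ᶠ a in 𝓝 t, 2 * (h - S.V (y (s a))) ≠ 0) :
    (∀ᶠ σ in 𝓝 (s t), HasDerivAt (coordCurve (E := E) (y (s t)) y)
      (chartDiff (y (s t)) (y σ) (velocity y σ)) σ) ∧
    deriv (coordCurve (E := E) (y (s t)) y) (s t) = (2 * (h - S.V (y (s t))))⁻¹ •
      chartDiff (y (s t)) (y (s t)) (velocity (y ∘ s) t) ∧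
    deriv (deriv (coordCurve (E := E) (y (s t)) y)) (s t) =
      (2 * (h - S.V (y (s t))))⁻¹ • ((2 * (h - S.V (y (s t))))⁻¹ •
        deriv (deriv (coordCurve (E := E) (y (s t)) (y ∘ s))) t +
        (-(-2 * S.potentialDeriv (y (s t)) (chartDiff (y (s t)) (y (s t)) (velocity (y ∘ s) t))) /
          (2 * (h - S.V (y (s t)))) ^ 2) •
          chartDiff (y (s t)) (y (s t)) (velocity (y ∘ s) t)) := by
  have hsrc := mem_extChartAt_source (I := 𝓘(ℝ, E)) (y (s t))
  have hfd := S.hasDerivAt_conformalFactor h (hx.mdifferentiableAt (by simp))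
  have hfc : ContinuousAt (fun a => 2 * (h - S.V (y (s a)))) t := hfd.continuousAt
  obtain ⟨r, hrt, hrc, hr⟩ := exists_local_inverse hs hfc hpos
  have hrc' : Tendsto r (𝓝 (s t)) (𝓝 t) := by
    have := hrc.tendsto
    rwa [hrt] at this
  have hq := hrc'.eventually (eventually_hasDerivAt_coordCurve hx hsrc)
  have hxd := hrc'.eventually ((contMDiffAt_iff_contMDiffAt_nhds (by simp)).mp hx)
  have hQ : coordCurve (E := E) (y (s t)) y =ᶠ[𝓝 (s t)]
      coordCurve (E := E) (y (s t)) (y ∘ s) ∘ r := by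
    filter_upwards [hr] with σ hσ
    change _ = extChartAt 𝓘(ℝ, E) (y (s t)) (y (s (r σ)))
    rw [hσ.1]
    rfl
  have hQ1 : ∀ᶠ σ in 𝓝 (s t), HasDerivAt (coordCurve (E := E) (y (s t)) y)
      ((2 * (h - S.V (y (s (r σ)))))⁻¹ •
        deriv (coordCurve (E := E) (y (s t)) (y ∘ s)) (r σ)) σ := by
    filter_upwards [hQ.eventuallyEq_nhds, hr, hq] with σ h1 h2 h3
    rw [h3.2.deriv]
    exact HasDerivAt.congr_of_eventuallyEq (h3.2.scomp σ h2.2) h1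
  have hv : deriv (coordCurve (E := E) (y (s t)) (y ∘ s)) t =
      chartDiff (y (s t)) (y (s t)) (velocity (y ∘ s) t) :=
    (eventually_hasDerivAt_coordCurve hx hsrc).self_of_nhds.2.deriv
  refine ⟨?_, ?_, ?_⟩
  · filter_upwards [hr.eventually_nhds, hq, hxd] with σ h2 h3 h4
    have hyd : MDifferentiableAt 𝓘(ℝ, ℝ) 𝓘(ℝ, E) y σ := by
      have h5 : MDifferentiableAt 𝓘(ℝ, ℝ) 𝓘(ℝ, E) ((y ∘ s) ∘ r) σ :=
        (h4.mdifferentiableAt (by simp)).comp σ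
          h2.self_of_nhds.2.differentiableAt.mdifferentiableAt
      refine h5.congr_of_eventuallyEq ?_
      filter_upwards [h2] with a ha
      change _ = y (s (r a))
      rw [ha.1]
    refine hasDerivAt_coordCurve hyd ?_
    have h6 := h3.1
    rwa [Function.comp_apply, h2.self_of_nhds.1] at h6
  · rw [hQ1.self_of_nhds.deriv, hrt, hv]
  · have h1 : deriv (coordCurve (E := E) (y (s t)) y) =ᶠ[𝓝 (s t)] fun σ =>
        (2 * (h - S.V (y (s (r σ)))))⁻¹ •
          deriv (coordCurve (E := E) (y (s t)) (y ∘ s)) (r σ) := hQ1.mono fun σ hσ => hσ.deriv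
    have h2 := hasDerivAt_deriv_coordCurve hx hsrc
    have h3 := hasDerivAt_reparam (f := fun a => 2 * (h - S.V (y (s a)))) (r := r) (τ := s t)
      (v := deriv (coordCurve (E := E) (y (s t)) (y ∘ s))) (by rw [hrt]; exact hfd)
      (by rw [hrt]; exact hpos.self_of_nhds) (by rw [hrt]; exact h2) hr.self_of_nhds.2
    rw [h1.deriv_eq, h3.deriv, hrt, hv]
    rfl

theorem lagrangeEquation_iff_curvature [FiniteDimensional ℝ E] (hdim : Module.finrank ℝ E = 2)
    {h : ℝ} {y : ℝ → M} {s : ℝ → ℝ} {t : ℝ}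
    (hx : ContMDiffAt 𝓘(ℝ, ℝ) 𝓘(ℝ, E) 2 (y ∘ s) t)
    (hs : ∀ᶠ a in 𝓝 t, HasDerivAt s (2 * (h - S.V (y (s a)))) a)
    (hregion : ∀ᶠ a in 𝓝 t, y (s a) ∈ S.region h)
    (hE : ∀ᶠ a in 𝓝 t, S.energy ⟨(y ∘ s) a, velocity (y ∘ s) a⟩ = h) :
    S.LagrangeEquation (y (s t)) (velocity (y ∘ s) t)
        (deriv (deriv (coordCurve (E := E) (y (s t)) (y ∘ s))) t) ↔
      (∃ (o : TangentSpace 𝓘(ℝ, E) (y (s t)) [⋀^Fin 2]→L[ℝ] ℝ) (k : ℝ),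
        (S.jacobiMetric h).IsAreaFormAt (y (s t)) o ∧ S.κ (y (s t)) = k • o ∧
        (S.jacobiMetric h).geodesicCurvature y (s t) = |k|) ∧
      (S.κ (y (s t)) ≠ 0 →
        0 < S.κ (y (s t)) ![(S.jacobiMetric h).curvatureVector y (s t), velocity y (s t)]) := by
  have hpos : ∀ᶠ a in 𝓝 t, 0 < 2 * (h - S.V (y (s a))) := hregion.mono fun a ha => by
    have : S.V (y (s a)) < h := ha
    linarith
  obtain ⟨hγ, hQ1, hQ2⟩ := S.arclength_reparam hx hs (hpos.mono fun a ha => ha.ne')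
  have hv := S.metricAt_velocity hE.self_of_nhds
  have hcov := S.lagrangeCovector_velocity hx hE
  dsimp only [Function.comp_apply] at hcov
  have hf0 : 0 < 2 * (h - S.V (y (s t))) := hpos.self_of_nhds
  obtain ⟨f, hf⟩ : ∃ f, 2 * (h - S.V (y (s t))) = f := ⟨_, rfl⟩
  obtain ⟨u, hu⟩ : ∃ u : TangentSpace 𝓘(ℝ, E) (y (s t)), velocity (y ∘ s) t = u := ⟨_, rfl⟩
  obtain ⟨v, hvu⟩ : ∃ v, chartDiff (y (s t)) (y (s t)) u = v := ⟨_, rfl⟩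
  have hv' : S.metricAt (y (s t)) v v = f := by rw [← hvu, ← hu, ← hf]; exact hv
  rw [hu, hvu] at hcov hQ1 hQ2
  rw [hf] at hQ1 hQ2 hf0
  have hcurv := S.jacobiMetric_curvatureVector hγ hf hf0 hv' hQ1 hQ2
  have hT : chartDiff (y (s t)) (y (s t)) (velocity y (s t)) = f⁻¹ • v := by
    rw [← hQ1]; exact hγ.self_of_nhds.deriv.symm
  have huT : u = f • velocity y (s t) := by
    apply chartDiff_injective (mem_extChartAt_source (y (s t)))
    rw [map_smul, hT, hvu, smul_smul, mul_inv_cancel₀ hf0.ne', one_smul]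
  have hTT : S.jacobiMetric h (y (s t)) (velocity y (s t)) (velocity y (s t)) = 1 := by
    rw [S.jacobiMetric_apply, hT, hf, map_smul, map_smul, smul_apply, hv', smul_eq_mul, smul_eq_mul]
    field_simp
  have hkT : S.jacobiMetric h (y (s t)) ((S.jacobiMetric h).curvatureVector y (s t))
      (velocity y (s t)) = 0 := by
    rw [hcurv, hT, S.lagrangeCovector_smul, hcov, mul_zero, mul_zero]
  have main := inner_eq_neg_twoForm_iff (F := TangentSpace 𝓘(ℝ, E) (y (s t))) hdim
    (S.jacobiMetric h (y (s t))) (S.jacobiMetric_symm h (y (s t)))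
    (fun _ hu => S.jacobiMetric_pos hregion.self_of_nhds hu) hTT hkT (S.κ (y (s t)))
  refine Iff.trans ?_ main
  have key : ∀ A B K K' : ℝ, B = f⁻¹ * A → K = f * K' → (A = -K ↔ B = -K') := by
    rintro A B K K' rfl rfl
    rw [← mul_neg, inv_mul_eq_iff_eq_mul₀ hf0.ne']
  rw [hu, S.lagrangeEquation_iff, hvu]
  refine forall_congr' fun Y => key _ _ _ _ (hcurv Y) ?_
  rw [huT]
  exact twoForm_smul (F := TangentSpace 𝓘(ℝ, E) (y (s t))) (S.κ (y (s t))) f _ Y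

end GyroSystem

end Gyro

end

theorem proposition5
    {E : Type*} [NormedAddCommGroup E] [NormedSpace ℝ E] [FiniteDimensional ℝ E]
    (hdim : Module.finrank ℝ E = 2)
    {M : Type*} [TopologicalSpace M] [ChartedSpace E M] [IsManifold 𝓘(ℝ, E) ∞ M]
    (S : Gyro.GyroSystem E M) (h : ℝ)
    -- a curve in the region of possible motions, satisfying the energy condition
    (J : Set ℝ) (hJopen : IsOpen J) (hJconn : J.OrdConnected)
    (x : ℝ → M) (hx : ContMDiffOn 𝓘(ℝ, ℝ) 𝓘(ℝ, E) 2 x J)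
    (hregion : ∀ t ∈ J, x t ∈ S.region h)
    (henergy : ∀ t ∈ J, S.energy ⟨x t, Gyro.velocity x t⟩ = h) :
    (∃ (L : Set ℝ) (y : ℝ → M), (S.jacobiMetric h).IsArclengthParam J x L y) ∧
    ∀ (L : Set ℝ) (y : ℝ → M), (S.jacobiMetric h).IsArclengthParam J x L y →
      (S.IsMotionOn x J ↔
        ∀ τ ∈ L,
          (∃ (o : TangentSpace 𝓘(ℝ, E) (y τ) [⋀^Fin 2]→L[ℝ] ℝ) (k : ℝ),
            (S.jacobiMetric h).IsAreaFormAt (y τ) o ∧ S.κ (y τ) = k • o ∧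
            (S.jacobiMetric h).geodesicCurvature y τ = |k|) ∧
          (S.κ (y τ) ≠ 0 →
            0 < S.κ (y τ) ![(S.jacobiMetric h).curvatureVector y τ, Gyro.velocity y τ])) := by
  have hnorm : ∀ t ∈ J, (S.jacobiMetric h).norm (Gyro.velocity x t) = 2 * (h - S.V (x t)) :=
    fun t ht => S.jacobiMetric_norm_velocity (hregion t ht) (henergy t ht)
  have hpos : ∀ t ∈ J, 0 < 2 * (h - S.V (x t)) := fun t ht => by
    have : S.V (x t) < h := hregion t ht
    linarith
  constructor
  · have hf : ContinuousOn (fun t => 2 * (h - S.V (x t))) J :=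
      continuousOn_const.mul (continuousOn_const.sub
        (S.V_smooth.continuous.comp_continuousOn hx.continuousOn))
    obtain ⟨s, hs⟩ := Gyro.exists_hasDerivAt_of_continuousOn hJopen hJconn hf
    have hinj : InjOn s J := by
      refine (strictMonoOn_of_deriv_pos hJconn.convex
        (fun t ht => (hs t ht).continuousAt.continuousWithinAt) fun t ht => ?_).injOn
      have ht' := interior_subset ht
      rw [(hs t ht').deriv]
      exact hpos t ht'
    refine ⟨s '' J, x ∘ Function.invFunOn s J, s, fun t ht => ?_, rfl, fun t ht => ?_⟩
    · rw [hnorm t ht]; exact hs t ht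
    · rw [Function.comp_apply, hinj.leftInvOn_invFunOn ht]
  · rintro L y ⟨s, hs, rfl, hy⟩
    have hxy : ∀ t ∈ J, x =ᶠ[nhds t] y ∘ s := fun t ht =>
      Filter.eventually_of_mem (hJopen.mem_nhds ht) hy
    have hx' : ContMDiffOn 𝓘(ℝ, ℝ) 𝓘(ℝ, E) 2 (y ∘ s) J := hx.congr fun t ht => (hy t ht).symm
    have hmot : S.IsMotionOn x J ↔ S.IsMotionOn (y ∘ s) J := by
      have h1 : ∀ (w : ℝ → TangentBundle 𝓘(ℝ, E) M),
          (∀ t ∈ J, x t = (w t).proj) ↔ ∀ t ∈ J, (y ∘ s) t = (w t).proj := fun w =>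
        forall₂_congr fun t ht => by rw [hy t ht, Function.comp_apply]
      simp only [Gyro.GyroSystem.IsMotionOn, h1]
    rw [hmot, S.isMotionOn_iff hJopen hx', forall_mem_image]
    refine forall₂_congr fun t ht => ?_
    have hJt := hJopen.mem_nhds ht
    refine S.lagrangeEquation_iff_curvature hdim (hx'.contMDiffAt hJt) ?_ ?_ ?_
    · filter_upwards [hJt] with a ha
      rw [← hy a ha, ← hnorm a ha]
      exact hs a ha
    · filter_upwards [hJt] with a ha
      rw [← hy a ha]
      exact hregion a ha
    · filter_upwards [hJt] with a ha
      have h2 : S.energy (Gyro.lift x a) = h := henergy a ha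
      rw [Gyro.lift_congr (hxy a ha)] at h2
      exact h2
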